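/- For $x\in[0,1]$ write $x=[x_1,x_2,\dots]$ for its continued fraction expansion $x=\cfrac{1}{x_1+\cfrac{1}{x_2+\cdots}}$ with partial quotients $x_i\in\{1,2,3,\dots\}$. Let $T(x)=1/x-\lfloor 1/x\rfloor$ (with $T(0)=0$) be the Gauss map, let $\gamma(A)=\frac1{\ln 2}\int_A\frac{dx}{1+x}$ be the Gauss measure on $[0,1]$, and for a finite word $w$ of natural numbers let $C_w\subseteq[0,1]$ be the set of all numbers whose sequence of partial quotients begins with $w$. A number $x\in[0,1]$ is called continued fraction normal if for every finite word $w$ $$\lim_{n\to\infty}\frac{|\{i : 0\le i\le n,\ T^i x\in C_w\}|}{n}=\gamma(C_w).$$ Let $x=[x_1,x_2,\dots]\in[0,1]$ be continued fraction normal, and let $k\ge 2$ and $b\ge 1$ be integers. Then there is exactly one number $y\in[0,1]$ with continued fraction expansion $y=[x_b,x_{b+k},x_{b+2k},\dots]$, and $y$ is not continued fraction normal. Moreover, the frequency of the block $[1,1]$ in $y$ exists and has the wrong value: $$\lim_{n\to\infty}\frac{|\{i : 0\le i\le n,\ T^i y\in C_{[1,1]}\}|}{n}=\gamma\bigl(C_{[1]}\cap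 T^{-k}C_{[1]}\bigr)\neq\gamma\bigl(C_{[1,1]}\bigr).$$ -/

import Mathlib

open MeasureTheory Filter Topology

noncomputable section

namespace CFNormality

/-- The Gauss map `x ↦ 1/x mod 1` (with the value `0` at `0`). On `[0; a₁, a₂, …]` it acts as the
left shift of the continued fraction expansion. -/
def gaussMap (x : ℝ) : ℝ := Int.fract (1 / x)

/-- The Gauss measure `γ(A) = (1 / ln 2) ∫_{A ∩ [0,1]} dx / (1 + x)`. -/
def gaussMeasure : Measure ℝ :=
  ENNReal.ofReal (1 / Real.log 2) •
    (volume.restrict (Set.Icc (0 : ℝ) 1)).withDensity (fun x => ENNReal.ofReal (1 / (1 + x)))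

/-- The finite word `w` is a prefix of the sequence of partial quotients `a₁, a₂, …` of `x`
(Mathlib's `partDens` is indexed from `0`, so `a₁` is entry `0`). -/
def IsCFPrefix (w : List ℕ) (x : ℝ) : Prop :=
  ∀ (i : ℕ) (h : i < w.length), (GenContFract.of x).partDens.get? i = some ((w[i] : ℕ) : ℝ)

/-- The cylinder `C_w` of all numbers of `[0,1]` whose continued fraction has the prefix `w`. -/
def cylinder (w : List ℕ) : Set ℝ := {x | x ∈ Set.Icc (0 : ℝ) 1 ∧ IsCFPrefix w x}

open Classical in
/-- The quotient `|{i | T^i x ∈ C_w, 0 ≤ i ≤ n}| / n`. -/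
def blockFreq (w : List ℕ) (x : ℝ) (n : ℕ) : ℝ :=
  (((Finset.range (n + 1)).filter (fun i => gaussMap^[i] x ∈ cylinder w)).card : ℝ) / n

/-- Continued fraction normality of a number in `[0,1]`: every finite block `w` occurs
(overlaps allowed) with asymptotic frequency `γ(C_w)`. -/
def IsCFNormal (x : ℝ) : Prop :=
  x ∈ Set.Icc (0 : ℝ) 1 ∧
    ∀ w : List ℕ, Tendsto (blockFreq w x) atTop (𝓝 (gaussMeasure (cylinder w)).toReal)

/-- `x ∈ [0,1]` has the infinite continued fraction expansion `[0; a 1, a 2, a 3, …]`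
(the value `a 0` plays no role). -/
def HasCFExpansion (x : ℝ) (a : ℕ → ℕ) : Prop :=
  x ∈ Set.Icc (0 : ℝ) 1 ∧
    ∀ n : ℕ, 1 ≤ n → (GenContFract.of x).partDens.get? (n - 1) = some ((a n : ℕ) : ℝ)

end CFNormality

end

/-! Write T for the Gauss map, γ for Gauss measure and G for the set of points whose partial
quotients number 1 and k+1 are both 1 (`gapOneSet k`). The point T^j y begins with 1,1 exactly when
T^(b-1+jk) x lies in G. So the frequency of [1,1] in y is the frequency of visits of the orbit of x
to G along a residue class modulo k, and two things are needed: this frequency equals γ(G), and γ(G)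
differs from γ(C_[1,1]).

For the first, normality gives the frequencies along all times of every set determined by finitely
many partial quotients (`IsCFNormal.hasMean_of_determined`). In particular the visits at times i and
i+mk have joint frequency γ(G ∩ T^(-mk) G), which tends to γ(G)² by mixing. Hence the centred visit
sequence has autocorrelations tending to 0 along multiples of k, and a van der Corput argument
(`hasMean_arithProg_of_autocorrelation`) makes its mean vanish on each residue class. No ergodic
theorem is used: x is one fixed point.

Mixing comes from the transfer operator U of T with respect to γ. It contracts Lipschitz constants
by 11/12 (`LipOnUnit.transferOp`), so the iterates of U on a Lipschitz function converge uniformly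
to its integral. The indicator of G is not Lipschitz, but becomes so after k+1 applications of U.

For the second, U² applied to the indicator of C_[1] is at least 3/8, so γ(G) ≥ (3/8) γ(C_[1]) when
k ≥ 2; explicit logarithms show that this exceeds γ(C_[1,1]) (`gaussMeasure_cylinder_one_one_lt`).

Existence of y is a compactness argument; uniqueness holds because two steps of the expansion
contract distances by 1/4. -/

namespace CFNormality

open GenContFract

/-! ### Partial quotients as digits along the Gauss orbit -/

/-- The `i`-th partial quotient, indexed from `0`, of a point of the unit interval. -/
noncomputable def cfDigit (x : ℝ) (i : ℕ) : ℕ := ⌊1 / gaussMap^[i] x⌋₊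

theorem gaussMap_mem_Ico (x : ℝ) : gaussMap x ∈ Set.Ico (0 : ℝ) 1 :=
  ⟨Int.fract_nonneg _, Int.fract_lt_one _⟩

theorem iterate_gaussMap_mem_Ico {x : ℝ} (hx : x ∈ Set.Ico (0 : ℝ) 1) (n : ℕ) :
    gaussMap^[n] x ∈ Set.Ico (0 : ℝ) 1 := by
  cases n with
  | zero => exact hx
  | succ n => rw [Function.iterate_succ_apply']; exact gaussMap_mem_Ico _

theorem gaussMap_zero : gaussMap 0 = 0 := by simp [gaussMap]

/-- On [0,1) the integer part is 0, so the algorithm's fractional parts are the Gauss orbit itself,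
and it stops exactly when the orbit reaches 0. -/
theorem stream_succ_eq {x : ℝ} (hx : x ∈ Set.Ico (0 : ℝ) 1) (n : ℕ) :
    IntFractPair.stream x (n + 1) =
      if gaussMap^[n] x = 0 then none else some (IntFractPair.of (gaussMap^[n] x)⁻¹) := by
  induction n with
  | zero =>
    have h0 : (IntFractPair.of x).fr = x := by
      simp only [IntFractPair.of]; exact Int.fract_eq_self.2 hx
    split_ifs with h
    · exact IntFractPair.stream_eq_none_of_fr_eq_zero (IntFractPair.stream_zero x) (by rw [h0]; exact h)
    · have := IntFractPair.stream_succ_of_some (IntFractPair.stream_zero x) (by rw [h0]; exact h)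
      rw [this, h0]; rfl
  | succ n ih =>
    by_cases h : gaussMap^[n] x = 0
    · have h' : gaussMap^[n + 1] x = 0 := by
        rw [Function.iterate_succ_apply', h, gaussMap_zero]
      rw [if_pos h] at ih
      rw [if_pos h']
      exact IntFractPair.succ_nth_stream_eq_none_iff.2 (Or.inl ih)
    · rw [if_neg h] at ih
      have h0 : (IntFractPair.of (gaussMap^[n] x)⁻¹).fr = gaussMap^[n + 1] x := by
        rw [Function.iterate_succ_apply']; simp [IntFractPair.of, gaussMap]
      split_ifs with h'
      · exact IntFractPair.stream_eq_none_of_fr_eq_zero ih (by rw [h0]; exact h')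
      · rw [IntFractPair.stream_succ_of_some ih (by rw [h0]; exact h'), h0]

/-- The nonvanishing clause matters: at an orbit point 0 the convention 1/0 = 0 gives `cfDigit` the
junk value 0, although the expansion has ended. -/
theorem partDens_get?_eq_some_iff {x : ℝ} (hx : x ∈ Set.Ico (0 : ℝ) 1) (i d : ℕ) :
    (GenContFract.of x).partDens.get? i = some (d : ℝ) ↔
      gaussMap^[i] x ≠ 0 ∧ cfDigit x i = d := by
  have hs := stream_succ_eq hx i
  by_cases h : gaussMap^[i] x = 0
  · rw [if_pos h] at hs
    have := of_terminatedAt_n_iff_succ_nth_intFractPair_stream_eq_none.2 hs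
    have h2 : (GenContFract.of x).s.get? i = none := this
    simp [partDens, h2, h]
  · rw [if_neg h] at hs
    have h2 := get?_of_eq_some_of_succ_get?_intFractPair_stream hs
    have hnn : 0 ≤ 1 / gaussMap^[i] x := one_div_nonneg.2 (iterate_gaussMap_mem_Ico hx i).1
    have hf : ((⌊1 / gaussMap^[i] x⌋ : ℤ) : ℝ) = ((cfDigit x i : ℕ) : ℝ) :=
      (natCast_floor_eq_intCast_floor hnn).symm
    rw [one_div] at hf
    simp [partDens, Stream'.Seq.map_get?, h2, h, IntFractPair.of, hf]

/-- The endpoint 1 is its own integer part and has no partial quotients; this lets everything below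
live on [0,1). -/
theorem partDens_one (i : ℕ) : (GenContFract.of (1 : ℝ)).partDens.get? i = none := by
  have h : (GenContFract.of (1 : ℝ)).s = Stream'.Seq.nil := by
    have := GenContFract.of_s_of_int ℝ 1
    simpa using this
  simp [partDens, h]

theorem mem_cylinder_iff {x : ℝ} (hx : x ∈ Set.Ico (0 : ℝ) 1) (w : List ℕ) :
    x ∈ cylinder w ↔
      ∀ (i : ℕ) (h : i < w.length), gaussMap^[i] x ≠ 0 ∧ cfDigit x i = w[i] := by
  simp only [cylinder, IsCFPrefix, Set.mem_ofPred_eq]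
  refine ⟨fun H i h => (partDens_get?_eq_some_iff hx i _).1 (H.2 i h), fun H =>
    ⟨Set.Ico_subset_Icc_self hx, fun i h => (partDens_get?_eq_some_iff hx i _).2 (H i h)⟩⟩

theorem cylinder_subset_Ico {w : List ℕ} (hw : w ≠ []) : cylinder w ⊆ Set.Ico (0 : ℝ) 1 := by
  intro x hx
  refine ⟨hx.1.1, lt_of_le_of_ne hx.1.2 ?_⟩
  rintro rfl
  have := hx.2 0 (List.length_pos_iff.2 hw)
  rw [partDens_one] at this
  exact absurd this (by simp)

theorem HasCFExpansion.mem_Ico {x : ℝ} {a : ℕ → ℕ} (h : HasCFExpansion x a) :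
    x ∈ Set.Ico (0 : ℝ) 1 := by
  refine ⟨h.1.1, lt_of_le_of_ne h.1.2 ?_⟩
  rintro rfl
  have := h.2 1 le_rfl
  rw [partDens_one] at this
  exact absurd this (by simp)

theorem hasCFExpansion_iff {x : ℝ} {a : ℕ → ℕ} :
    HasCFExpansion x a ↔
      x ∈ Set.Ico (0 : ℝ) 1 ∧ ∀ i, gaussMap^[i] x ≠ 0 ∧ cfDigit x i = a (i + 1) := by
  constructor
  · intro h
    refine ⟨h.mem_Ico, fun i => (partDens_get?_eq_some_iff h.mem_Ico i _).1 ?_⟩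
    simpa using h.2 (i + 1) (by omega)
  · rintro ⟨hx, h⟩
    refine ⟨Set.Ico_subset_Icc_self hx, fun n hn => ?_⟩
    obtain ⟨m, rfl⟩ : ∃ m, n = m + 1 := ⟨n - 1, by omega⟩
    exact (partDens_get?_eq_some_iff hx m _).2 (h m)

theorem cfDigit_iterate (x : ℝ) (i j : ℕ) : cfDigit (gaussMap^[i] x) j = cfDigit x (i + j) := by
  simp only [cfDigit, ← Function.iterate_add_apply, add_comm]

theorem one_div_eq_cfDigit_add {z : ℝ} (hz : 0 ≤ z) :
    1 / z = cfDigit z 0 + gaussMap z := by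
  have h := natCast_floor_eq_intCast_floor (one_div_nonneg.2 hz)
  simp only [cfDigit, Function.iterate_zero, id, gaussMap]
  rw [h, Int.floor_add_fract]

theorem one_le_cfDigit {x : ℝ} (hx : x ∈ Set.Ico (0 : ℝ) 1) {i : ℕ} (h : gaussMap^[i] x ≠ 0) :
    1 ≤ cfDigit x i := by
  have h1 := iterate_gaussMap_mem_Ico hx i
  have h2 : 0 < gaussMap^[i] x := lt_of_le_of_ne h1.1 h.symm
  exact Nat.le_floor (by rw [Nat.cast_one, le_div_iff₀ h2]; linarith [h1.2])

theorem gaussMap_one_div_add {t : ℝ} (ht : t ∈ Set.Ico (0 : ℝ) 1) (n : ℕ) :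
    gaussMap (1 / (n + t)) = t := by
  simp only [gaussMap, one_div, inv_inv]
  rw [add_comm, Int.fract_add_natCast, Int.fract_eq_self.2 ht]

theorem cfDigit_one_div_add {t : ℝ} (ht : t ∈ Set.Ico (0 : ℝ) 1) (n : ℕ) :
    cfDigit (1 / (n + t)) 0 = n := by
  simp only [cfDigit, Function.iterate_zero, id, one_div, inv_inv]
  rw [Nat.floor_eq_iff (by have := ht.1; positivity)]
  exact ⟨by linarith [ht.1], by linarith [ht.2]⟩

/-! ### Measurability and the explicit cylinders -/

@[fun_prop]
theorem measurable_gaussMap : Measurable gaussMap := by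
  unfold gaussMap; fun_prop

theorem measurable_cfDigit (i : ℕ) : Measurable fun x => cfDigit x i := by
  have := measurable_gaussMap.iterate i
  unfold cfDigit; fun_prop

theorem measurableSet_cylinder {w : List ℕ} (hw : w ≠ []) : MeasurableSet (cylinder w) := by
  have : cylinder w = Set.Ico 0 1 ∩
      ⋂ (i : ℕ) (h : i < w.length), {x | gaussMap^[i] x ≠ 0 ∧ cfDigit x i = w[i]} := by
    ext x
    by_cases hx : x ∈ Set.Ico (0 : ℝ) 1
    · simp only [mem_cylinder_iff hx, Set.mem_inter_iff, hx, Set.mem_iInter, true_and,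
        Set.mem_ofPred_eq]
    · exact ⟨fun h => absurd (cylinder_subset_Ico hw h) hx, fun h => absurd h.1 hx⟩
  rw [this]
  refine measurableSet_Ico.inter (.iInter fun i => .iInter fun h => .inter ?_ ?_)
  · exact (measurable_gaussMap.iterate i) (measurableSet_singleton 0).compl
  · exact (measurable_cfDigit i) (measurableSet_singleton _)

theorem cylinder_singleton_one : cylinder [1] = Set.Ioo (1 / 2 : ℝ) 1 := by
  ext x
  constructor
  · intro h
    have hx := cylinder_subset_Ico (by simp) h
    have h2 := (mem_cylinder_iff hx _).1 h 0 (by simp)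
    simp only [Function.iterate_zero, id, List.getElem_cons_zero] at h2
    have h3 := one_div_eq_cfDigit_add hx.1
    rw [h2.2] at h3
    have h4 := (gaussMap_mem_Ico x).2
    have h5 : 0 < x := lt_of_le_of_ne hx.1 h2.1.symm
    refine ⟨?_, hx.2⟩
    have h6 : 1 / x < 2 := by rw [h3]; push_cast; linarith
    rw [div_lt_iff₀ h5] at h6
    linarith
  · intro h
    have hx : x ∈ Set.Ico (0 : ℝ) 1 := ⟨by linarith [h.1], h.2⟩
    have h5 : 0 < x := by linarith [h.1]
    refine (mem_cylinder_iff hx _).2 fun i hi => ?_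
    obtain rfl : i = 0 := by simpa using hi
    simp only [Function.iterate_zero, id, List.getElem_cons_zero]
    refine ⟨h5.ne', ?_⟩
    simp only [cfDigit, Function.iterate_zero, id]
    rw [Nat.floor_eq_iff (by positivity), le_div_iff₀ h5, div_lt_iff₀ h5]
    push_cast
    constructor <;> linarith [h.1, h.2]

theorem cylinder_one_one : cylinder [1, 1] = Set.Ioo (1 / 2 : ℝ) (2 / 3) := by
  have key : ∀ x : ℝ, x ∈ Set.Ico (0 : ℝ) 1 →
      (x ∈ cylinder [1, 1] ↔ x ∈ cylinder [1] ∧ gaussMap x ∈ cylinder [1]) := by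
    intro x hx
    rw [mem_cylinder_iff hx, mem_cylinder_iff hx, mem_cylinder_iff (gaussMap_mem_Ico x)]
    constructor
    · intro h
      refine ⟨fun i hi => ?_, fun i hi => ?_⟩
      · obtain rfl : i = 0 := by simpa using hi
        simpa using h 0 (by simp)
      · obtain rfl : i = 0 := by simpa using hi
        simpa [cfDigit] using h 1 (by simp)
    · rintro ⟨h1, h2⟩ i hi
      have hi' : i = 0 ∨ i = 1 := by simp at hi; omega
      rcases hi' with rfl | rfl
      · simpa using h1 0 (by simp)
      · simpa [cfDigit] using h2 0 (by simp)
  ext x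
  by_cases hx : x ∈ Set.Ico (0 : ℝ) 1
  · rw [key x hx, cylinder_singleton_one]
    simp only [Set.mem_Ioo]
    constructor
    · rintro ⟨⟨h1, h2⟩, h3, h4⟩
      have hx0 : 0 < x := by linarith
      have hd : cfDigit x 0 = 1 := by
        have : x ∈ cylinder [1] := by rw [cylinder_singleton_one]; exact ⟨h1, h2⟩
        simpa using ((mem_cylinder_iff hx _).1 this 0 (by simp)).2
      have h5 := one_div_eq_cfDigit_add hx.1
      rw [hd, div_eq_iff hx0.ne'] at h5
      push_cast at h5
      exact ⟨h1, by nlinarith⟩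
    · rintro ⟨h1, h2⟩
      have hx0 : 0 < x := by linarith
      have hd : cfDigit x 0 = 1 := by
        have : x ∈ cylinder [1] := by rw [cylinder_singleton_one]; exact ⟨h1, by linarith⟩
        simpa using ((mem_cylinder_iff hx _).1 this 0 (by simp)).2
      have h5 := one_div_eq_cfDigit_add hx.1
      rw [hd, div_eq_iff hx0.ne'] at h5
      push_cast at h5
      refine ⟨⟨h1, by linarith⟩, by nlinarith, by nlinarith⟩
  · refine ⟨fun h => absurd (cylinder_subset_Ico (by simp) h) hx, fun h => absurd ?_ hx⟩
    exact ⟨by linarith [h.1], by linarith [h.2]⟩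

/-! ### Gauss measure -/

theorem integral_gaussMeasure (f : ℝ → ℝ) :
    ∫ x, f x ∂gaussMeasure = (1 / Real.log 2) * ∫ x in Set.Ioo (0 : ℝ) 1, f x * (1 / (1 + x)) := by
  have hl : 0 ≤ 1 / Real.log 2 := by positivity
  rw [gaussMeasure, integral_smul_measure, ENNReal.toReal_ofReal hl, smul_eq_mul,
    integral_withDensity_eq_integral_toReal_smul (by fun_prop) (by simp),
    ← integral_Icc_eq_integral_Ioo]
  congr 1
  refine setIntegral_congr_fun measurableSet_Icc fun x hx => ?_
  have : 0 ≤ 1 / (1 + x) := one_div_nonneg.2 (by linarith [hx.1])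
  simp only [ENNReal.toReal_ofReal this, smul_eq_mul, mul_comm]

theorem gaussMeasure_absolutelyContinuous : gaussMeasure ≪ volume.restrict (Set.Ioo (0 : ℝ) 1) := by
  rw [Measure.restrict_congr_set Ioo_ae_eq_Icc]
  exact (withDensity_absolutelyContinuous _ _).smul_left _

theorem ae_gaussMeasure_mem_Ioo : ∀ᵐ x ∂gaussMeasure, x ∈ Set.Ioo (0 : ℝ) 1 :=
  gaussMeasure_absolutelyContinuous.ae_le (ae_restrict_mem measurableSet_Ioo)

instance : IsFiniteMeasure gaussMeasure := by
  have : IsFiniteMeasure ((volume.restrict (Set.Icc (0 : ℝ) 1)).withDensity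
      (fun x => ENNReal.ofReal (1 / (1 + x)))) := by
    refine isFiniteMeasure_withDensity (ne_of_lt ?_)
    calc ∫⁻ x in Set.Icc (0 : ℝ) 1, ENNReal.ofReal (1 / (1 + x))
        ≤ ∫⁻ x in Set.Icc (0 : ℝ) 1, 1 := by
          refine setLIntegral_mono measurable_const fun x hx => ?_
          rw [ENNReal.ofReal_le_one, div_le_one (by linarith [hx.1])]
          linarith [hx.1]
      _ < ⊤ := by simp
  exact Measure.smul_finite _ ENNReal.ofReal_ne_top

theorem gaussMeasure_real_Ioo {u v : ℝ} (hu : 0 ≤ u) (huv : u ≤ v) (hv : v ≤ 1) :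
    gaussMeasure.real (Set.Ioo u v) = Real.log ((1 + v) / (1 + u)) / Real.log 2 := by
  have h := integral_gaussMeasure (Set.indicator (Set.Ioo u v) 1)
  rw [integral_indicator_one measurableSet_Ioo] at h
  have h1 : ∀ x : ℝ, Set.indicator (Set.Ioo u v) (1 : ℝ → ℝ) x * (1 / (1 + x)) =
      Set.indicator (Set.Ioo u v) (fun x => 1 / (1 + x)) x := by
    intro x
    by_cases hx : x ∈ Set.Ioo u v <;> simp [hx]
  simp_rw [h1] at h
  rw [setIntegral_indicator measurableSet_Ioo,
    Set.inter_eq_self_of_subset_right (Set.Ioo_subset_Ioo hu hv),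
    ← integral_Ioc_eq_integral_Ioo, ← intervalIntegral.integral_of_le huv] at h
  have h2 : ∫ x in u..v, 1 / (1 + x) = Real.log ((1 + v) / (1 + u)) := by
    rw [intervalIntegral.integral_comp_add_left (fun x => 1 / x) 1,
      integral_one_div_of_pos (by linarith) (by linarith)]
  rw [h, h2]; ring

instance : IsProbabilityMeasure gaussMeasure := by
  have h := gaussMeasure_real_Ioo le_rfl zero_le_one le_rfl
  have hl : Real.log 2 ≠ 0 := (Real.log_pos (by norm_num)).ne'
  have h0 : gaussMeasure (Set.Ioo (0 : ℝ) 1) = 1 := by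
    rw [show (1 + 1 : ℝ) / (1 + 0) = 2 by norm_num, div_self hl, Measure.real] at h
    exact (ENNReal.toReal_eq_one_iff _).1 h
  refine ⟨le_antisymm ?_ (h0 ▸ measure_mono (Set.subset_univ _))⟩
  rw [← h0]
  refine measure_mono_ae ?_
  filter_upwards [ae_gaussMeasure_mem_Ioo] with x hx _ using hx

/-! ### The transfer operator and invariance of Gauss measure -/

/-- The weights `p_n(x)` of the Gauss–Kuzmin–Wirsing operator with respect to Gauss measure. -/
noncomputable def gkwWeight (n : ℕ) (x : ℝ) : ℝ := (1 + x) / ((n + 1 + x) * (n + 2 + x))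

/-- The tails `∑_{m ≥ n} p_m(x)` of the weights. -/
noncomputable def gkwTail (n : ℕ) (x : ℝ) : ℝ := (1 + x) / (n + 1 + x)

open Classical in
/-- The transfer operator of the Gauss map with respect to Gauss measure, on the open unit
interval (extended by `0`). -/
noncomputable def transferOp (f : ℝ → ℝ) (x : ℝ) : ℝ :=
  if x ∈ Set.Ioo (0 : ℝ) 1 then ∑' n : ℕ, gkwWeight n x * f (1 / (n + 1 + x)) else 0

theorem gkwWeight_nonneg {x : ℝ} (hx : 0 < x) (n : ℕ) : 0 ≤ gkwWeight n x := by
  unfold gkwWeight; positivity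

/-- This telescoping form is used twice: to sum the weights to 1, and for the Abel summation behind
the contraction estimate. -/
theorem gkwWeight_eq_sub {x : ℝ} (hx : 0 < x) (n : ℕ) :
    gkwWeight n x = gkwTail n x - gkwTail (n + 1) x := by
  unfold gkwWeight gkwTail
  have h1 : (n : ℝ) + 1 + x ≠ 0 := by positivity
  have h2 : (n : ℝ) + 2 + x ≠ 0 := by positivity
  have h3 : (n : ℝ) + 1 + 1 + x ≠ 0 := by positivity
  push_cast
  field_simp
  ring

theorem tendsto_gkwTail (x : ℝ) : Tendsto (fun n => gkwTail n x) atTop (𝓝 0) := by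
  unfold gkwTail
  refine Tendsto.const_div_atTop ?_ _
  have : Tendsto (fun n : ℕ => (n : ℝ)) atTop atTop := tendsto_natCast_atTop_atTop
  simpa [add_assoc] using tendsto_atTop_add_const_right _ (1 + x) this

theorem gkwTail_zero {x : ℝ} (hx : 0 < x) : gkwTail 0 x = 1 := by
  unfold gkwTail
  rw [Nat.cast_zero, zero_add, div_self (by linarith)]

theorem sum_range_gkwWeight {x : ℝ} (hx : 0 < x) (N : ℕ) :
    ∑ n ∈ Finset.range N, gkwWeight n x = 1 - gkwTail N x := by
  simp_rw [gkwWeight_eq_sub hx]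
  rw [Finset.sum_range_sub' (fun n => gkwTail n x), gkwTail_zero hx]

theorem hasSum_gkwWeight {x : ℝ} (hx : 0 < x) : HasSum (fun n => gkwWeight n x) 1 := by
  rw [hasSum_iff_tendsto_nat_of_nonneg (gkwWeight_nonneg hx)]
  simp_rw [sum_range_gkwWeight hx]
  simpa using (tendsto_gkwTail x).const_sub 1

theorem one_div_add_mem_Ioo {x : ℝ} (hx : x ∈ Set.Ioo (0 : ℝ) 1) (n : ℕ) :
    1 / ((n : ℝ) + 1 + x) ∈ Set.Ioo (0 : ℝ) 1 := by
  have h := hx.1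
  refine ⟨by positivity, ?_⟩
  rw [div_lt_one (by positivity)]
  have : (0 : ℝ) ≤ n := by positivity
  linarith

theorem summable_gkwWeight_mul {x : ℝ} (hx : 0 < x) {a : ℕ → ℝ} {M : ℝ} (ha : ∀ n, |a n| ≤ M) :
    Summable fun n => gkwWeight n x * a n := by
  refine Summable.of_norm_bounded ((hasSum_gkwWeight hx).summable.mul_right M) fun n => ?_
  rw [Real.norm_eq_abs, abs_mul, abs_of_nonneg (gkwWeight_nonneg hx n)]
  exact mul_le_mul_of_nonneg_left (ha n) (gkwWeight_nonneg hx n)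

theorem abs_transferOp_le {f : ℝ → ℝ} {M : ℝ} (hf : ∀ x, |f x| ≤ M) (x : ℝ) :
    |transferOp f x| ≤ M := by
  have hM : 0 ≤ M := (abs_nonneg _).trans (hf 0)
  unfold transferOp
  split_ifs with hx
  · have h1 := (hasSum_gkwWeight hx.1).mul_right M
    rw [one_mul] at h1
    rw [← Real.norm_eq_abs]
    refine tsum_of_norm_bounded h1 fun n => ?_
    rw [Real.norm_eq_abs, abs_mul, abs_of_nonneg (gkwWeight_nonneg hx.1 n)]
    exact mul_le_mul_of_nonneg_left (hf _) (gkwWeight_nonneg hx.1 n)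
  · simpa using hM

theorem measurable_transferOp {f : ℝ → ℝ} (hf : Measurable f) : Measurable (transferOp f) := by
  unfold transferOp
  refine Measurable.ite measurableSet_Ioo ?_ measurable_const
  refine Measurable.tsum fun n => ?_
  unfold gkwWeight
  fun_prop

/-- Every inverse branch 1/(n+1+x) is sent back to x by the Gauss map, so the factor g is constant
along the sum. -/
theorem transferOp_mul_comp (f g : ℝ → ℝ) (x : ℝ) :
    transferOp (fun y => f y * g (gaussMap y)) x = transferOp f x * g x := by
  unfold transferOp
  split_ifs with hx
  · rw [← tsum_mul_right]
    refine tsum_congr fun n => ?_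
    have := gaussMap_one_div_add (Set.Ioo_subset_Ico_self hx) (n + 1)
    push_cast at this
    simp only [this, mul_assoc]
  · simp

theorem iUnion_image_one_div :
    ⋃ n : ℕ, (fun x : ℝ => 1 / ((n : ℝ) + 1 + x)) '' Set.Ioo 0 1 =ᵐ[volume] Set.Ioo (0 : ℝ) 1 := by
  have hsub : (⋃ n : ℕ, (fun x : ℝ => 1 / ((n : ℝ) + 1 + x)) '' Set.Ioo 0 1) ⊆
      Set.Ioo (0 : ℝ) 1 := by
    refine Set.iUnion_subset fun n => ?_
    rintro _ ⟨x, hx, rfl⟩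
    exact one_div_add_mem_Ioo hx n
  refine hsub.eventuallyLE.antisymm ?_
  -- Only points 1/n, whose Gauss image is 0, are missed by the open branches.
  have hc : (Set.range fun n : ℕ => 1 / (n : ℝ)).Countable := Set.countable_range _
  filter_upwards [hc.ae_notMem volume] with z hz hz01
  have hz' : z ∈ Set.Ioo (0 : ℝ) 1 := hz01
  have h1 := one_div_eq_cfDigit_add hz'.1.le
  have hd : 1 ≤ cfDigit z 0 := one_le_cfDigit (Set.Ioo_subset_Ico_self hz') (i := 0) hz'.1.ne'
  have hT : gaussMap z ≠ 0 := by
    intro h0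
    rw [h0, add_zero] at h1
    exact hz ⟨cfDigit z 0, by simp only [← h1, one_div, inv_inv]⟩
  refine Set.mem_iUnion.2 ⟨cfDigit z 0 - 1, gaussMap z, ⟨?_, (gaussMap_mem_Ico z).2⟩, ?_⟩
  · exact lt_of_le_of_ne (gaussMap_mem_Ico z).1 hT.symm
  · simp only [Nat.cast_sub hd, Nat.cast_one, sub_add_cancel, ← h1, one_div, inv_inv]

theorem pairwise_disjoint_image_one_div :
    Pairwise (Function.onFun Disjoint
      fun n : ℕ => (fun x : ℝ => 1 / ((n : ℝ) + 1 + x)) '' Set.Ioo 0 1) := by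
  intro m n hmn
  refine Set.disjoint_left.2 ?_
  rintro _ ⟨x, hx, rfl⟩ ⟨y, hy, hxy⟩
  apply hmn
  have h1 := cfDigit_one_div_add (Set.Ioo_subset_Ico_self hx) (m + 1)
  have h2 := cfDigit_one_div_add (Set.Ioo_subset_Ico_self hy) (n + 1)
  push_cast at h1 h2
  simp only at hxy
  rw [← hxy, h2] at h1
  omega

theorem integrable_of_abs_le {f : ℝ → ℝ} {M : ℝ} {μ : Measure ℝ} [IsFiniteMeasure μ]
    (hf : Measurable f) (hM : ∀ x, |f x| ≤ M) : Integrable f μ :=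
  Integrable.of_bound hf.aestronglyMeasurable M (Eventually.of_forall hM)

/-- The transfer operator is dual to composition with the Gauss map. -/
theorem integral_mul_comp_gaussMap {f g : ℝ → ℝ} {M K : ℝ} (hf : Measurable f) (hg : Measurable g)
    (hM : ∀ x, |f x| ≤ M) (hK : ∀ x, |g x| ≤ K) :
    ∫ x, f x * g (gaussMap x) ∂gaussMeasure = ∫ x, transferOp f x * g x ∂gaussMeasure := by
  set F : ℝ → ℝ := fun x => f x * g (gaussMap x)
  have hFm : Measurable F := by fun_prop
  have hM0 : 0 ≤ M := (abs_nonneg _).trans (hM 0)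
  have hFb : ∀ x, |F x| ≤ M * K := fun x => by
    simp only [F, abs_mul]
    exact mul_le_mul (hM _) (hK _) (abs_nonneg _) hM0
  have hUF : (fun x => transferOp f x * g x) = transferOp F :=
    funext fun x => (transferOp_mul_comp f g x).symm
  rw [hUF, integral_gaussMeasure, integral_gaussMeasure]
  congr 1
  set D : ℕ → Set ℝ := fun n => (fun x : ℝ => 1 / ((n : ℝ) + 1 + x)) '' Set.Ioo 0 1
  have hderiv : ∀ n : ℕ, ∀ x ∈ Set.Ioo (0 : ℝ) 1,
      HasDerivWithinAt (fun x : ℝ => 1 / ((n : ℝ) + 1 + x)) (-1 / ((n : ℝ) + 1 + x) ^ 2)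
        (Set.Ioo 0 1) x := by
    intro n x hx
    have h0 : (n : ℝ) + 1 + x ≠ 0 := by have := hx.1; positivity
    have h1 : HasDerivAt (fun x : ℝ => (n : ℝ) + 1 + x) 1 x := (hasDerivAt_id x).const_add _
    have h2 : HasDerivAt (fun x : ℝ => ((n : ℝ) + 1 + x)⁻¹) (-1 / ((n : ℝ) + 1 + x) ^ 2) x :=
      h1.fun_inv h0
    simpa only [one_div] using h2.hasDerivWithinAt
  have hinj : ∀ n : ℕ, Set.InjOn (fun x : ℝ => 1 / ((n : ℝ) + 1 + x)) (Set.Ioo 0 1) := by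
    intro n x hx y hy hxy
    have := hx.1
    have := hy.1
    simp only [one_div, inv_inj] at hxy
    linarith
  have hDm : ∀ n, MeasurableSet (D n) := fun n =>
    measurableSet_Ioo.image_of_continuousOn_injOn
      (fun x hx => (hderiv n x hx).continuousWithinAt) (hinj n)
  have hI : IntegrableOn (fun x => F x * (1 / (1 + x))) (Set.Ioo (0 : ℝ) 1) := by
    refine Measure.integrableOn_of_bounded (M := M * K) (by simp) (by fun_prop) ?_
    filter_upwards [ae_restrict_mem measurableSet_Ioo] with x hx
    rw [Real.norm_eq_abs, abs_mul]
    refine (mul_le_of_le_one_right (abs_nonneg _) ?_).trans (hFb x)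
    rw [abs_of_nonneg (one_div_nonneg.2 (by linarith [hx.1])), div_le_one (by linarith [hx.1])]
    linarith [hx.1]
  have hsum : HasSum (fun n => ∫ x in D n, F x * (1 / (1 + x)))
      (∫ x in Set.Ioo (0 : ℝ) 1, F x * (1 / (1 + x))) := by
    rw [← setIntegral_congr_set iUnion_image_one_div]
    exact hasSum_integral_iUnion hDm pairwise_disjoint_image_one_div
      (hI.congr_set_ae iUnion_image_one_div)
  -- Change of variables on branch n: the Jacobian 1/(n+1+x)² times the density at the image is the
  -- weight times the density at x.
  have hterm : ∀ n, ∫ x in D n, F x * (1 / (1 + x)) =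
      ∫ x in Set.Ioo (0 : ℝ) 1, gkwWeight n x * F (1 / (n + 1 + x)) * (1 / (1 + x)) := by
    intro n
    rw [integral_image_eq_integral_abs_deriv_smul measurableSet_Ioo (hderiv n) (hinj n)]
    refine setIntegral_congr_fun measurableSet_Ioo fun x hx => ?_
    have := hx.1
    have h1 : |(-1 / ((n : ℝ) + 1 + x) ^ 2)| = 1 / ((n : ℝ) + 1 + x) ^ 2 := by
      rw [neg_div, abs_neg, abs_of_nonneg (by positivity)]
    simp only [h1, smul_eq_mul, gkwWeight]
    have h2 : 1 + 1 / ((n : ℝ) + 1 + x) = (n + 2 + x) / (n + 1 + x) := by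
      field_simp; ring
    rw [h2]
    field_simp
  have hp : ∀ n, ∀ x ∈ Set.Ioo (0 : ℝ) 1,
      ‖gkwWeight n x * F (1 / (n + 1 + x)) * (1 / (1 + x))‖ ≤ gkwWeight n x * (M * K) := by
    intro n x hx
    have hx0 := hx.1
    rw [Real.norm_eq_abs, abs_mul, abs_mul, abs_of_nonneg (gkwWeight_nonneg hx0 n)]
    refine (mul_le_of_le_one_right (mul_nonneg (gkwWeight_nonneg hx0 n) (abs_nonneg _)) ?_).trans
      (mul_le_mul_of_nonneg_left (hFb _) (gkwWeight_nonneg hx0 n))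
    · rw [abs_of_nonneg (by positivity), div_le_one (by positivity)]
      linarith
  have hsum2 : HasSum (fun n : ℕ => ∫ x in Set.Ioo (0 : ℝ) 1,
      gkwWeight n x * F (1 / (n + 1 + x)) * (1 / (1 + x)))
      (∫ x in Set.Ioo (0 : ℝ) 1, transferOp F x * (1 / (1 + x))) := by
    refine hasSum_integral_of_dominated_convergence (fun n x => gkwWeight n x * (M * K))
      (fun n => ?_) (fun n => ?_) ?_ ?_ ?_
    · unfold gkwWeight; fun_prop
    · filter_upwards [ae_restrict_mem measurableSet_Ioo] with x hx using hp n x hx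
    · filter_upwards [ae_restrict_mem measurableSet_Ioo] with x hx using
        (hasSum_gkwWeight hx.1).summable.mul_right _
    · have : IntegrableOn (fun _ : ℝ => M * K) (Set.Ioo (0 : ℝ) 1) :=
        integrableOn_const (by simp)
      refine this.congr ?_
      filter_upwards [ae_restrict_mem measurableSet_Ioo] with x hx
      rw [((hasSum_gkwWeight hx.1).mul_right (M * K)).tsum_eq, one_mul]
    · filter_upwards [ae_restrict_mem measurableSet_Ioo] with x hx
      rw [transferOp, if_pos hx]
      exact (summable_gkwWeight_mul hx.1 (fun n => hFb _)).hasSum.mul_right _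
  simp_rw [hterm] at hsum
  exact hsum.unique hsum2

theorem abs_transferOp_iterate_le {f : ℝ → ℝ} {M : ℝ} (hf : ∀ x, |f x| ≤ M) (n : ℕ) (x : ℝ) :
    |transferOp^[n] f x| ≤ M := by
  induction n generalizing x with
  | zero => exact hf x
  | succ n ih => rw [Function.iterate_succ_apply']; exact abs_transferOp_le ih x

theorem measurable_transferOp_iterate {f : ℝ → ℝ} (hf : Measurable f) (n : ℕ) :
    Measurable (transferOp^[n] f) := by
  induction n with
  | zero => exact hf
  | succ n ih => rw [Function.iterate_succ_apply']; exact measurable_transferOp ih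

theorem integral_mul_comp_gaussMap_iterate {f g : ℝ → ℝ} {M K : ℝ} (hf : Measurable f)
    (hg : Measurable g) (hM : ∀ x, |f x| ≤ M) (hK : ∀ x, |g x| ≤ K) (n : ℕ) :
    ∫ x, f x * g (gaussMap^[n] x) ∂gaussMeasure =
      ∫ x, transferOp^[n] f x * g x ∂gaussMeasure := by
  induction n generalizing f with
  | zero => rfl
  | succ n ih =>
    rw [Function.iterate_succ_apply, ← ih (measurable_transferOp hf) (abs_transferOp_le hM)]
    exact integral_mul_comp_gaussMap (g := fun x => g (gaussMap^[n] x)) hf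
      (hg.comp (measurable_gaussMap.iterate n)) hM (fun x => hK _)

theorem transferOp_iterate_mul_comp (f g : ℝ → ℝ) (n : ℕ) (x : ℝ) :
    transferOp^[n] (fun y => f y * g (gaussMap^[n] y)) x = transferOp^[n] f x * g x := by
  induction n generalizing f with
  | zero => rfl
  | succ n ih =>
    have h : transferOp (fun y => f y * g (gaussMap^[n + 1] y)) =
        fun y => transferOp f y * g (gaussMap^[n] y) :=
      funext fun y => transferOp_mul_comp f (fun z => g (gaussMap^[n] z)) y
    rw [Function.iterate_succ_apply, Function.iterate_succ_apply, ← ih, h]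

/-- Duality with f = 1: the operator fixes constants because the weights sum to 1. -/
theorem measurePreserving_gaussMap : MeasurePreserving gaussMap gaussMeasure gaussMeasure := by
  refine ⟨measurable_gaussMap, ?_⟩
  ext s hs
  rw [Measure.map_apply measurable_gaussMap hs]
  have hb : ∀ x, |s.indicator (1 : ℝ → ℝ) x| ≤ 1 := fun x => by
    by_cases hx : x ∈ s <;> simp [hx]
  have h := integral_mul_comp_gaussMap (f := fun _ => 1) (g := s.indicator 1) (M := 1) (K := 1)
    measurable_const (measurable_one.indicator hs) (by simp) hb
  have h1 : ∫ x, transferOp (fun _ => 1) x * s.indicator (1 : ℝ → ℝ) x ∂gaussMeasure =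
      ∫ x, s.indicator (1 : ℝ → ℝ) x ∂gaussMeasure := by
    refine integral_congr_ae ?_
    filter_upwards [ae_gaussMeasure_mem_Ioo] with x hx
    simp only [transferOp, if_pos hx, mul_one, (hasSum_gkwWeight hx.1).tsum_eq, one_mul]
  have h2 : (fun x => (1 : ℝ) * s.indicator (1 : ℝ → ℝ) (gaussMap x)) =
      (gaussMap ⁻¹' s).indicator 1 := by
    ext x; by_cases hx : gaussMap x ∈ s <;> simp [hx, Set.indicator]
  rw [h1, h2, integral_indicator_one (measurable_gaussMap hs), integral_indicator_one hs] at h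
  exact (measureReal_eq_measureReal_iff).1 h

/-! ### Lipschitz contraction and decay of correlations -/

/-- `f` is Lipschitz with constant `L` on the open unit interval. -/
def LipOnUnit (f : ℝ → ℝ) (L : ℝ) : Prop :=
  ∀ x ∈ Set.Ioo (0 : ℝ) 1, ∀ y ∈ Set.Ioo (0 : ℝ) 1, |f x - f y| ≤ L * |x - y|

theorem LipOnUnit.nonneg {f : ℝ → ℝ} {L : ℝ} (h : LipOnUnit f L) : 0 ≤ L := by
  have := (abs_nonneg _).trans
    (h (1 / 2) ⟨by norm_num, by norm_num⟩ (1 / 4) ⟨by norm_num, by norm_num⟩)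
  rw [show |(1 / 2 : ℝ) - 1 / 4| = 1 / 4 by norm_num [abs_of_pos]] at this
  linarith

theorem sum_one_div_cube_le (N : ℕ) : ∑ n ∈ Finset.range N, 1 / ((n : ℝ) + 2) ^ 3 ≤ 1 / 4 := by
  -- The induction needs the remainder term: 1/(n+2)³ is dominated by the telescoping differences of
  -- 1/(2(n+1)(n+2)).
  have h : ∀ N : ℕ, ∑ n ∈ Finset.range N, 1 / ((n : ℝ) + 2) ^ 3 ≤
      1 / 4 - 1 / (2 * ((N : ℝ) + 1) * (N + 2)) := by
    intro N
    induction N with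
    | zero => norm_num
    | succ N ih =>
      rw [Finset.sum_range_succ]
      have : 1 / ((N : ℝ) + 2) ^ 3 ≤
          1 / (2 * ((N : ℝ) + 1) * (N + 2)) - 1 / (2 * ((N : ℝ) + 1 + 1) * (N + 1 + 2)) := by
        rw [div_sub_div _ _ (by positivity) (by positivity),
          div_le_div_iff₀ (by positivity) (by positivity)]
        have hN : (0 : ℝ) ≤ N := by positivity
        have : 0 ≤ 4 * ((N : ℝ) + 2) := by positivity
        nlinarith [this]
      push_cast
      linarith
  have : 0 ≤ 1 / (2 * ((N : ℝ) + 1) * (N + 2)) := by positivity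
  linarith [h N]

theorem abel_sum (D a : ℕ → ℝ) (h0 : D 0 = 0) (N : ℕ) :
    ∑ n ∈ Finset.range (N + 1), (D n - D (n + 1)) * a n =
      ∑ n ∈ Finset.range N, D (n + 1) * (a (n + 1) - a n) - D (N + 1) * a N := by
  induction N with
  | zero => simp [h0]
  | succ N ih => rw [Finset.sum_range_succ, ih, Finset.sum_range_succ]; ring

theorem abs_one_div_sub_one_div {u v : ℝ} (hu : 0 < u) (hv : 0 < v) :
    |1 / u - 1 / v| = |u - v| / (u * v) := by
  rw [div_sub_div _ _ hu.ne' hv.ne', abs_div, abs_of_pos (mul_pos hu hv), one_mul, mul_one,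
    abs_sub_comm]

/-- Branch 0 has weight at most 1/2 and does not expand. The other branches contract by 1/4 and have
total weight at most 2/3, since branch 0 has weight at least 1/3. Thus 1/2 + (1/4)(2/3) = 2/3. -/
theorem sum_gkwWeight_mul_abs_sub_le {f : ℝ → ℝ} {L : ℝ} (hf : LipOnUnit f L) {x y : ℝ}
    (hx : x ∈ Set.Ioo (0 : ℝ) 1) (hy : y ∈ Set.Ioo (0 : ℝ) 1) (N : ℕ) :
    ∑ n ∈ Finset.range (N + 1), gkwWeight n x * |f (1 / (n + 1 + x)) - f (1 / (n + 1 + y))| ≤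
      2 / 3 * (L * |x - y|) := by
  have hL := hf.nonneg
  have hx0 := hx.1
  have hy0 := hy.1
  have hb : ∀ n : ℕ, |f (1 / (n + 1 + x)) - f (1 / (n + 1 + y))| ≤
      (L * |x - y|) * (1 / ((n + 1 + x) * (n + 1 + y))) := by
    intro n
    refine (hf _ (one_div_add_mem_Ioo hx n) _ (one_div_add_mem_Ioo hy n)).trans_eq ?_
    rw [abs_one_div_sub_one_div (by positivity) (by positivity)]
    rw [show (n : ℝ) + 1 + x - (n + 1 + y) = x - y by ring]
    ring
  have hLx : 0 ≤ L * |x - y| := by positivity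
  rw [Finset.sum_range_succ']
  have h0 : gkwWeight 0 x * |f (1 / ((0 : ℕ) + 1 + x)) - f (1 / ((0 : ℕ) + 1 + y))| ≤
      1 / 2 * (L * |x - y|) := by
    have h1 : gkwWeight 0 x ≤ 1 / 2 := by
      unfold gkwWeight
      rw [div_le_div_iff₀ (by positivity) (by positivity)]
      push_cast
      nlinarith
    have h2 : |f (1 / ((0 : ℕ) + 1 + x)) - f (1 / ((0 : ℕ) + 1 + y))| ≤ L * |x - y| := by
      refine (hb 0).trans (mul_le_of_le_one_right hLx ?_)
      rw [div_le_one (by positivity)]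
      push_cast
      nlinarith
    exact mul_le_mul h1 h2 (abs_nonneg _) (by norm_num)
  have h1 : ∑ n ∈ Finset.range N,
      gkwWeight (n + 1) x * |f (1 / ((n + 1 : ℕ) + 1 + x)) - f (1 / ((n + 1 : ℕ) + 1 + y))| ≤
      ∑ n ∈ Finset.range N, gkwWeight (n + 1) x * (1 / 4 * (L * |x - y|)) := by
    refine Finset.sum_le_sum fun n _ => mul_le_mul_of_nonneg_left ?_ (gkwWeight_nonneg hx0 _)
    refine (hb (n + 1)).trans ?_
    rw [mul_comm]
    refine mul_le_mul_of_nonneg_right ?_ hLx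
    refine one_div_le_one_div_of_le (by norm_num) ?_
    have hn : (0 : ℝ) ≤ n := by positivity
    push_cast
    nlinarith
  have h2 : ∑ n ∈ Finset.range N, gkwWeight (n + 1) x ≤ 2 / 3 := by
    have h3 := sum_range_gkwWeight hx0 (N + 1)
    rw [Finset.sum_range_succ'] at h3
    have h4 : 0 ≤ gkwTail (N + 1) x := by unfold gkwTail; positivity
    have h5 : 1 / 3 ≤ gkwWeight 0 x := by
      unfold gkwWeight
      rw [div_le_div_iff₀ (by positivity) (by positivity)]
      push_cast
      nlinarith [hx.2]
    linarith
  rw [← Finset.sum_mul] at h1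
  have h6 := mul_le_mul_of_nonneg_right h2 (show 0 ≤ 1 / 4 * (L * |x - y|) by positivity)
  linarith

/-- Abel summation moves the differences onto f at consecutive branches, where f varies by at most
L/((n+1)(n+2)). The tails vary by at most |x-y|(n+1)/(n+2)², and the products sum by the cube bound
1/4. The boundary term with M disappears as N grows. -/
theorem abs_sum_gkwWeight_sub_mul_le {f : ℝ → ℝ} {L M : ℝ} (hf : LipOnUnit f L)
    (hM : ∀ x, |f x| ≤ M) {x y : ℝ}
    (hx : x ∈ Set.Ioo (0 : ℝ) 1) (hy : y ∈ Set.Ioo (0 : ℝ) 1) (N : ℕ) :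
    |∑ n ∈ Finset.range (N + 1), (gkwWeight n x - gkwWeight n y) * f (1 / (n + 1 + y))| ≤
      1 / 4 * (L * |x - y|) + |gkwTail (N + 1) x - gkwTail (N + 1) y| * M := by
  have hL := hf.nonneg
  have hx0 := hx.1
  have hy0 := hy.1
  have hLx : 0 ≤ L * |x - y| := by positivity
  set D : ℕ → ℝ := fun n => gkwTail n x - gkwTail n y
  set a : ℕ → ℝ := fun n => f (1 / (n + 1 + y))
  have hD0 : D 0 = 0 := by simp [D, gkwTail_zero hx0, gkwTail_zero hy0]
  have hw : ∀ n, gkwWeight n x - gkwWeight n y = D n - D (n + 1) := fun n => by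
    rw [gkwWeight_eq_sub hx0, gkwWeight_eq_sub hy0]; simp only [D]; ring
  have hsum : ∑ n ∈ Finset.range (N + 1), (gkwWeight n x - gkwWeight n y) * f (1 / (n + 1 + y)) =
      ∑ n ∈ Finset.range N, D (n + 1) * (a (n + 1) - a n) - D (N + 1) * a N := by
    rw [← abel_sum D a hD0]
    exact Finset.sum_congr rfl fun n _ => by rw [hw]
  rw [hsum]
  refine (abs_sub _ _).trans (add_le_add ?_ ?_)
  · refine (Finset.abs_sum_le_sum_abs _ _).trans ?_
    refine (Finset.sum_le_sum (g := fun n : ℕ => 1 / ((n : ℝ) + 2) ^ 3 * (L * |x - y|))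
      fun n _ => ?_).trans ?_
    · have hDn : |D (n + 1)| ≤ |x - y| * ((n + 1) / ((n : ℝ) + 2) ^ 2) := by
        have : D (n + 1) = (x - y) * ((n + 1) / ((n + 2 + x) * (n + 2 + y))) := by
          simp only [D, gkwTail]
          have h1 : (n : ℝ) + 1 + 1 + x ≠ 0 := by positivity
          have h2 : (n : ℝ) + 1 + 1 + y ≠ 0 := by positivity
          have h3 : (n : ℝ) + 2 + x ≠ 0 := by positivity
          have h4 : (n : ℝ) + 2 + y ≠ 0 := by positivity
          push_cast
          field_simp
          ring
        rw [this, abs_mul]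
        refine mul_le_mul_of_nonneg_left ?_ (abs_nonneg _)
        rw [abs_of_nonneg (by positivity)]
        refine div_le_div_of_nonneg_left (by positivity) (by positivity) ?_
        rw [sq]
        exact mul_le_mul (by linarith) (by linarith) (by positivity) (by positivity)
      have han : |a (n + 1) - a n| ≤ L * (1 / ((n + 2) * (n + 1))) := by
        refine (hf _ (one_div_add_mem_Ioo hy (n + 1)) _ (one_div_add_mem_Ioo hy n)).trans ?_
        refine mul_le_mul_of_nonneg_left ?_ hL
        rw [abs_one_div_sub_one_div (by positivity) (by positivity)]
        push_cast
        rw [show (n : ℝ) + 1 + 1 + y - (n + 1 + y) = 1 by ring, abs_one]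
        refine one_div_le_one_div_of_le (by positivity) ?_
        exact mul_le_mul (by linarith) (by linarith) (by positivity) (by positivity)
      rw [abs_mul]
      refine (mul_le_mul hDn han (abs_nonneg _) (by positivity)).trans_eq ?_
      field_simp
    · rw [← Finset.sum_mul]
      exact mul_le_mul_of_nonneg_right (sum_one_div_cube_le N) hLx
  · rw [abs_mul]
    exact mul_le_mul_of_nonneg_left (hM _) (abs_nonneg _)

/-- Moving the branch points costs 2/3 and moving the weights costs 1/4; the point is that 2/3 + 1/4
= 11/12 < 1. -/
theorem LipOnUnit.transferOp {f : ℝ → ℝ} {L M : ℝ} (hf : LipOnUnit f L)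
    (hM : ∀ x, |f x| ≤ M) : LipOnUnit (transferOp f) (11 / 12 * L) := by
  intro x hx y hy
  have hx0 := hx.1
  have hy0 := hy.1
  have hsx := (summable_gkwWeight_mul hx0
    (a := fun n : ℕ => f (1 / (n + 1 + x))) (fun n => hM _)).hasSum.tendsto_sum_nat
  have hsy := (summable_gkwWeight_mul hy0
    (a := fun n : ℕ => f (1 / (n + 1 + y))) (fun n => hM _)).hasSum.tendsto_sum_nat
  have hlim := ((hsx.sub hsy).abs).comp (tendsto_add_atTop_nat 1)
  have hDlim : Tendsto (fun N => 11 / 12 * L * |x - y| +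
      |gkwTail (N + 1) x - gkwTail (N + 1) y| * M) atTop (𝓝 (11 / 12 * L * |x - y|)) := by
    have h := ((((tendsto_gkwTail x).sub (tendsto_gkwTail y)).abs.mul_const M).comp
      (tendsto_add_atTop_nat 1)).const_add (11 / 12 * L * |x - y|)
    simpa using h
  unfold CFNormality.transferOp
  rw [if_pos hx, if_pos hy]
  refine le_of_tendsto_of_tendsto' hlim hDlim fun N => ?_
  have h1 := sum_gkwWeight_mul_abs_sub_le hf hx hy N
  have h2 := abs_sum_gkwWeight_sub_mul_le hf hM hx hy N
  have h3 : ∑ n ∈ Finset.range (N + 1), gkwWeight n x * f (1 / (n + 1 + x)) -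
      ∑ n ∈ Finset.range (N + 1), gkwWeight n y * f (1 / (n + 1 + y)) =
      ∑ n ∈ Finset.range (N + 1), gkwWeight n x * (f (1 / (n + 1 + x)) - f (1 / (n + 1 + y))) +
      ∑ n ∈ Finset.range (N + 1), (gkwWeight n x - gkwWeight n y) * f (1 / (n + 1 + y)) := by
    rw [← Finset.sum_sub_distrib, ← Finset.sum_add_distrib]
    exact Finset.sum_congr rfl fun n _ => by ring
  have h4 : |∑ n ∈ Finset.range (N + 1),
      gkwWeight n x * (f (1 / (n + 1 + x)) - f (1 / (n + 1 + y)))| ≤ 2 / 3 * (L * |x - y|) := by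
    refine (Finset.abs_sum_le_sum_abs _ _).trans (le_trans (le_of_eq ?_) h1)
    exact Finset.sum_congr rfl fun n _ => by rw [abs_mul, abs_of_nonneg (gkwWeight_nonneg hx0 n)]
  simp only [Function.comp]
  rw [h3]
  refine (abs_add_le _ _).trans ?_
  linarith

theorem LipOnUnit.transferOp_iterate {f : ℝ → ℝ} {L M : ℝ} (hf : LipOnUnit f L)
    (hM : ∀ x, |f x| ≤ M) (n : ℕ) : LipOnUnit (CFNormality.transferOp^[n] f) ((11 / 12) ^ n * L) := by
  induction n with
  | zero => simpa using hf
  | succ n ih =>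
    rw [Function.iterate_succ_apply', pow_succ', mul_assoc]
    exact ih.transferOp (abs_transferOp_iterate_le hM n)

theorem integral_transferOp_iterate {f : ℝ → ℝ} {M : ℝ} (hf : Measurable f)
    (hM : ∀ x, |f x| ≤ M) (n : ℕ) :
    ∫ x, transferOp^[n] f x ∂gaussMeasure = ∫ x, f x ∂gaussMeasure := by
  have := integral_mul_comp_gaussMap_iterate (g := fun _ => 1) hf measurable_const hM
    (K := 1) (by simp) n
  simpa using this.symm

/-- The iterate keeps the integral of f, and its oscillation on an interval of length 1 is at most
its Lipschitz constant. -/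
theorem abs_transferOp_iterate_sub_integral_le {f : ℝ → ℝ} {L M : ℝ} (hf : LipOnUnit f L)
    (hfm : Measurable f) (hM : ∀ x, |f x| ≤ M) (n : ℕ) {x : ℝ} (hx : x ∈ Set.Ioo (0 : ℝ) 1) :
    |transferOp^[n] f x - ∫ y, f y ∂gaussMeasure| ≤ (11 / 12) ^ n * L := by
  have hL := hf.nonneg
  have hint : Integrable (transferOp^[n] f) gaussMeasure :=
    integrable_of_abs_le (measurable_transferOp_iterate hfm n) (abs_transferOp_iterate_le hM n)
  rw [← integral_transferOp_iterate hfm hM n]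
  have h1 : transferOp^[n] f x - ∫ y, transferOp^[n] f y ∂gaussMeasure =
      ∫ y, (transferOp^[n] f x - transferOp^[n] f y) ∂gaussMeasure := by
    rw [integral_sub (integrable_const _) hint]; simp
  rw [h1, ← Real.norm_eq_abs]
  refine (norm_integral_le_of_norm_le_const (C := (11 / 12) ^ n * L) ?_).trans_eq (by simp)
  filter_upwards [ae_gaussMeasure_mem_Ioo] with y hy
  refine (hf.transferOp_iterate hM n x hx y hy).trans (mul_le_of_le_one_right (by positivity) ?_)
  rw [abs_le]
  constructor <;> linarith [hx.1, hx.2, hy.1, hy.2]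

/-- Decay of correlations for observables that become Lipschitz under the transfer operator. -/
theorem tendsto_integral_mul_comp_iterate {f g : ℝ → ℝ} {L M K : ℝ} {p : ℕ} (hf : Measurable f)
    (hg : Measurable g) (hM : ∀ x, |f x| ≤ M) (hK : ∀ x, |g x| ≤ K)
    (hLip : LipOnUnit (transferOp^[p] f) L) :
    Tendsto (fun n => ∫ x, f x * g (gaussMap^[n] x) ∂gaussMeasure) atTop
      (𝓝 ((∫ x, f x ∂gaussMeasure) * ∫ x, g x ∂gaussMeasure)) := by
  have hK0 : 0 ≤ K := (abs_nonneg _).trans (hK 0)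
  -- Spend p applications on making f Lipschitz; only the remaining n contract.
  rw [← tendsto_add_atTop_iff_nat p, tendsto_iff_norm_sub_tendsto_zero]
  have hlim : Tendsto (fun n : ℕ => ((11 / 12 : ℝ) ^ n * L) * K) atTop (𝓝 0) := by
    have := ((tendsto_pow_atTop_nhds_zero_of_lt_one (r := (11 / 12 : ℝ)) (by norm_num)
      (by norm_num)).mul_const L).mul_const K
    simpa using this
  refine squeeze_zero (fun _ => norm_nonneg _) (fun n => ?_) hlim
  have hgi : Integrable g gaussMeasure := integrable_of_abs_le hg hK
  have hfm := measurable_transferOp_iterate hf p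
  have hfb := abs_transferOp_iterate_le hM p
  have hUi : Integrable (fun x => transferOp^[n + p] f x * g x) gaussMeasure := by
    refine integrable_of_abs_le (M := M * K)
      ((measurable_transferOp_iterate hf _).mul hg) fun x => ?_
    rw [abs_mul]
    exact mul_le_mul (abs_transferOp_iterate_le hM _ x) (hK x) (abs_nonneg _)
      ((abs_nonneg _).trans (hM 0))
  rw [integral_mul_comp_gaussMap_iterate hf hg hM hK, ← integral_const_mul,
    ← integral_sub hUi (hgi.const_mul _)]
  refine (norm_integral_le_of_norm_le_const (C := ((11 / 12) ^ n * L) * K) ?_).trans_eq (by simp)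
  filter_upwards [ae_gaussMeasure_mem_Ioo] with x hx
  rw [← sub_mul, norm_mul, Real.norm_eq_abs, Real.norm_eq_abs, Function.iterate_add_apply,
    ← integral_transferOp_iterate hf hM p]
  exact mul_le_mul (abs_transferOp_iterate_sub_integral_le hLip hfm hfb n hx) (hK x)
    (abs_nonneg _) (mul_nonneg (by positivity) hLip.nonneg)

/-! ### Two ones at distance k: the wrong value, and mixing -/

/-- The indicator function of `C_{[1]}`. -/
noncomputable def oneInd : ℝ → ℝ := (cylinder [1]).indicator 1

theorem measurable_oneInd : Measurable oneInd :=
  measurable_one.indicator (measurableSet_cylinder (by simp))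

theorem abs_indicator_one_le (s : Set ℝ) (x : ℝ) : |s.indicator (1 : ℝ → ℝ) x| ≤ 1 := by
  by_cases hx : x ∈ s <;> simp [hx]

theorem abs_oneInd_le (x : ℝ) : |oneInd x| ≤ 1 := abs_indicator_one_le _ x

/-- Only branch 0 lands in C_[1] = (1/2, 1), so the series has a single term; this also smooths the
jump of the indicator. -/
theorem transferOp_oneInd_mul (ψ : ℝ → ℝ) {x : ℝ} (hx : x ∈ Set.Ioo (0 : ℝ) 1) :
    transferOp (fun y => oneInd y * ψ y) x = 1 / (2 + x) * ψ (1 / (1 + x)) := by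
  have hx0 := hx.1
  rw [transferOp, if_pos hx, tsum_eq_single 0]
  · have h1 : oneInd (1 / (1 + x)) = 1 := by
      have : 1 / (1 + x) ∈ cylinder [1] := by
        rw [cylinder_singleton_one]
        constructor
        · rw [div_lt_div_iff₀ (by positivity) (by positivity)]; linarith [hx.2]
        · rw [div_lt_one (by positivity)]; linarith
      rw [oneInd, Set.indicator_of_mem this, Pi.one_apply]
    have h2 : gkwWeight 0 x = 1 / (2 + x) := by
      unfold gkwWeight
      push_cast
      field_simp
      ring
    simp only [Nat.cast_zero, zero_add, h1, h2, one_mul]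
  · intro n hn
    have : 1 / ((n : ℝ) + 1 + x) ∉ cylinder [1] := by
      rw [cylinder_singleton_one]
      intro h
      have h1 := h.1
      have h2 : (1 : ℝ) ≤ n := by exact_mod_cast Nat.one_le_iff_ne_zero.2 hn
      rw [div_lt_div_iff₀ (by positivity) (by positivity)] at h1
      linarith
    simp only [oneInd, Set.indicator_of_notMem this, zero_mul, mul_zero]

theorem transferOp_oneInd {x : ℝ} (hx : x ∈ Set.Ioo (0 : ℝ) 1) :
    transferOp oneInd x = 1 / (2 + x) := by
  have := transferOp_oneInd_mul (fun _ => 1) hx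
  simpa using this

theorem lipOnUnit_transferOp_oneInd : LipOnUnit (transferOp oneInd) 1 := by
  intro x hx y hy
  have hx0 := hx.1
  have hy0 := hy.1
  rw [transferOp_oneInd hx, transferOp_oneInd hy, abs_one_div_sub_one_div (by positivity)
    (by positivity), one_mul, add_sub_add_left_eq_sub]
  exact div_le_self (abs_nonneg _) (by nlinarith)

/-- The n-th term is (1+x)/2 over (n+2+x)(n+3/2+x). Replacing that product by the larger
(n+4/3+x)(n+7/3+x) makes the series telescope to (1+x)/(2(4/3+x)), which is at least its value 3/8
at x = 0. -/
theorem le_transferOp_transferOp_oneInd {x : ℝ} (hx : x ∈ Set.Ioo (0 : ℝ) 1) :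
    3 / 8 ≤ transferOp (transferOp oneInd) x := by
  have hx0 := hx.1
  have hs := (summable_gkwWeight_mul hx0 (a := fun n : ℕ => transferOp oneInd (1 / (n + 1 + x)))
    (fun n => abs_transferOp_le abs_oneInd_le _)).hasSum.tendsto_sum_nat
  have hlim : Tendsto (fun N : ℕ => (1 + x) / 2 * (1 / (4 / 3 + x) - 1 / ((N : ℝ) + 4 / 3 + x)))
      atTop (𝓝 ((1 + x) / 2 * (1 / (4 / 3 + x) - 0))) := by
    refine ((Tendsto.const_div_atTop ?_ _).const_sub _).const_mul _
    have : Tendsto (fun n : ℕ => (n : ℝ)) atTop atTop := tendsto_natCast_atTop_atTop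
    simpa [add_assoc] using tendsto_atTop_add_const_right _ (4 / 3 + x) this
  have hle : (1 + x) / 2 * (1 / (4 / 3 + x) - 0) ≤ transferOp (transferOp oneInd) x := by
    rw [transferOp, if_pos hx]
    refine le_of_tendsto_of_tendsto' hlim hs fun N => ?_
    have hterm : ∀ n : ℕ, (1 + x) / 2 * (1 / ((n : ℝ) + 4 / 3 + x) - 1 / ((n + 1 : ℕ) + 4 / 3 + x))
        ≤ gkwWeight n x * transferOp oneInd (1 / (n + 1 + x)) := by
      intro n
      rw [transferOp_oneInd (one_div_add_mem_Ioo hx n)]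
      have h1 : gkwWeight n x * (1 / (2 + 1 / ((n : ℝ) + 1 + x))) =
          (1 + x) / 2 * (1 / ((n + 2 + x) * (n + 3 / 2 + x))) := by
        unfold gkwWeight
        have h2 : 2 + 1 / ((n : ℝ) + 1 + x) = 2 * (n + 3 / 2 + x) / (n + 1 + x) := by
          field_simp; ring
        rw [h2]
        field_simp
      have h3 : 1 / ((n : ℝ) + 4 / 3 + x) - 1 / ((n + 1 : ℕ) + 4 / 3 + x) =
          1 / ((n + 4 / 3 + x) * (n + 7 / 3 + x)) := by
        push_cast
        rw [div_sub_div _ _ (by positivity) (by positivity)]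
        congr 1 <;> ring
      rw [h1, h3]
      refine mul_le_mul_of_nonneg_left (one_div_le_one_div_of_le (by positivity) ?_) (by positivity)
      have hn : (0 : ℝ) ≤ n := by positivity
      nlinarith
    have htel := Finset.sum_range_sub' (fun n : ℕ => 1 / ((n : ℝ) + 4 / 3 + x)) N
    have := Finset.sum_le_sum fun n (_ : n ∈ Finset.range N) => hterm n
    rw [← Finset.mul_sum, htel] at this
    simpa using this
  refine le_trans ?_ hle
  rw [sub_zero, div_mul_div_comm, div_le_div_iff₀ (by positivity) (by positivity)]
  linarith

/-- The set of points whose partial quotients number `1` and `k + 1` are both `1`. -/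
def gapOneSet (k : ℕ) : Set ℝ := cylinder [1] ∩ gaussMap^[k] ⁻¹' cylinder [1]

theorem measurableSet_gapOneSet (k : ℕ) : MeasurableSet (gapOneSet k) :=
  (measurableSet_cylinder (by simp)).inter
    (measurable_gaussMap.iterate k (measurableSet_cylinder (by simp)))

theorem indicator_inter_preimage (s t : Set ℝ) (k : ℕ) :
    (s ∩ gaussMap^[k] ⁻¹' t).indicator (1 : ℝ → ℝ) =
      fun x => s.indicator 1 x * t.indicator 1 (gaussMap^[k] x) := by
  rw [Set.inter_indicator_one]; rfl

theorem measureReal_inter_preimage {s t : Set ℝ} (hs : MeasurableSet s) (ht : MeasurableSet t)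
    (k : ℕ) : gaussMeasure.real (s ∩ gaussMap^[k] ⁻¹' t) =
      ∫ x, s.indicator 1 x * t.indicator (1 : ℝ → ℝ) (gaussMap^[k] x) ∂gaussMeasure := by
  rw [← integral_indicator_one (hs.inter (measurable_gaussMap.iterate k ht)),
    indicator_inter_preimage]

/-- Two of the k steps are moved by duality onto the first indicator, where the bound 3/8 applies;
the other k-2 steps preserve the measure. This is where k ≥ 2 enters. -/
theorem le_gaussMeasure_gapOneSet {k : ℕ} (hk : 2 ≤ k) :
    3 / 8 * gaussMeasure.real (cylinder [1]) ≤ gaussMeasure.real (gapOneSet k) := by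
  have hm : MeasurableSet (cylinder [1]) := measurableSet_cylinder (by simp)
  obtain ⟨j, rfl⟩ : ∃ j, k = j + 2 := ⟨k - 2, by omega⟩
  have hinv : ∫ x, oneInd (gaussMap^[j] x) ∂gaussMeasure = gaussMeasure.real (cylinder [1]) := by
    have h := integral_mul_comp_gaussMap_iterate (f := fun _ => 1) measurable_const
      measurable_oneInd (M := 1) (by simp) abs_oneInd_le j
    have hmp := measurePreserving_gaussMap.iterate j
    have h1 : (fun x => oneInd (gaussMap^[j] x)) =
        (gaussMap^[j] ⁻¹' cylinder [1]).indicator (1 : ℝ → ℝ) := rfl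
    rw [h1, integral_indicator_one (hmp.measurable hm),
      hmp.measureReal_preimage hm.nullMeasurableSet]
  have hg : Measurable fun x => oneInd (gaussMap^[j] x) :=
    measurable_oneInd.comp (measurable_gaussMap.iterate j)
  have h2 := integral_mul_comp_gaussMap_iterate (g := fun x => oneInd (gaussMap^[j] x))
    measurable_oneInd hg abs_oneInd_le (fun x => abs_oneInd_le _) 2
  rw [gapOneSet, measureReal_inter_preimage hm hm]
  have h3 : ∫ x, oneInd x * oneInd (gaussMap^[j] (gaussMap^[2] x)) ∂gaussMeasure =
      ∫ x, (cylinder [1]).indicator 1 x *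
        (cylinder [1]).indicator (1 : ℝ → ℝ) (gaussMap^[j + 2] x) ∂gaussMeasure := by
    simp only [← Function.iterate_add_apply]; rfl
  rw [← h3, h2, ← hinv, ← integral_const_mul]
  have hUm := measurable_transferOp_iterate measurable_oneInd 2
  refine integral_mono_ae
    ((integrable_of_abs_le hg fun x => abs_oneInd_le _).const_mul _)
    (integrable_of_abs_le (hUm.mul hg) (M := 1) fun x => ?_) ?_
  · rw [abs_mul]
    exact mul_le_one₀ (abs_transferOp_iterate_le abs_oneInd_le 2 x) (abs_nonneg _) (abs_oneInd_le _)
  · filter_upwards [ae_gaussMeasure_mem_Ioo] with x hx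
    refine mul_le_mul_of_nonneg_right (le_transferOp_transferOp_oneInd hx) ?_
    exact Set.indicator_nonneg (fun _ _ => zero_le_one) _

theorem gaussMeasure_cylinder_one_one_lt {k : ℕ} (hk : 2 ≤ k) :
    gaussMeasure.real (cylinder [1, 1]) < gaussMeasure.real (gapOneSet k) := by
  refine lt_of_lt_of_le ?_ (le_gaussMeasure_gapOneSet hk)
  have hl : 0 < Real.log 2 := Real.log_pos (by norm_num)
  rw [cylinder_one_one, cylinder_singleton_one,
    gaussMeasure_real_Ioo (by norm_num) (by norm_num) (by norm_num),
    gaussMeasure_real_Ioo (by norm_num) (by norm_num) (by norm_num), ← mul_div_assoc]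
  refine div_lt_div_of_pos_right ?_ hl
  -- After multiplication by 8 log 2 the claim is (10/9)^8 < (4/3)^3.
  have h : 8 * Real.log (10 / 9) < 3 * Real.log (4 / 3) := by
    have h1 := Real.log_lt_log (x := (10 / 9 : ℝ) ^ 8) (y := (4 / 3) ^ 3) (by positivity)
      (by norm_num)
    rw [Real.log_pow, Real.log_pow] at h1
    exact_mod_cast h1
  rw [show ((1 : ℝ) + 2 / 3) / (1 + 1 / 2) = 10 / 9 by norm_num,
    show ((1 : ℝ) + 1) / (1 + 1 / 2) = 4 / 3 by norm_num]
  linarith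

/-- After k applications the second indicator comes out as a factor, leaving a Lipschitz function
times the indicator of C_[1]; one more application removes that jump through the single branch 0. -/
theorem exists_lipOnUnit_transferOp_gapOneSet {k : ℕ} (hk : 1 ≤ k) :
    ∃ L, LipOnUnit (transferOp^[k + 1] ((gapOneSet k).indicator 1)) L := by
  obtain ⟨j, rfl⟩ : ∃ j, k = j + 1 := ⟨k - 1, by omega⟩
  set ψ := transferOp^[j + 1] oneInd
  have hψ : LipOnUnit ψ ((11 / 12) ^ j * 1) :=
    lipOnUnit_transferOp_oneInd.transferOp_iterate (abs_transferOp_le abs_oneInd_le) j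
  have hψb : ∀ x, |ψ x| ≤ 1 := abs_transferOp_iterate_le abs_oneInd_le _
  have hU : transferOp^[j + 1] ((gapOneSet (j + 1)).indicator 1) =
      fun x => oneInd x * ψ x := by
    rw [gapOneSet, indicator_inter_preimage]
    funext x
    rw [mul_comm]
    exact transferOp_iterate_mul_comp oneInd oneInd (j + 1) x
  refine ⟨1 + (11 / 12) ^ j * 1, fun x hx y hy => ?_⟩
  have hx0 := hx.1
  have hy0 := hy.1
  rw [Function.iterate_succ_apply', hU, transferOp_oneInd_mul ψ hx, transferOp_oneInd_mul ψ hy]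
  have h1 : |1 / (2 + x) - 1 / (2 + y)| ≤ |x - y| := by
    have := lipOnUnit_transferOp_oneInd x hx y hy
    rwa [transferOp_oneInd hx, transferOp_oneInd hy, one_mul] at this
  have h2 : |ψ (1 / (1 + x)) - ψ (1 / (1 + y))| ≤ (11 / 12) ^ j * 1 * |x - y| := by
    have hx' := one_div_add_mem_Ioo hx 0
    have hy' := one_div_add_mem_Ioo hy 0
    rw [Nat.cast_zero, zero_add] at hx' hy'
    refine (hψ _ hx' _ hy').trans (mul_le_mul_of_nonneg_left ?_ (by positivity))
    rw [abs_one_div_sub_one_div (by positivity) (by positivity), add_sub_add_left_eq_sub]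
    exact div_le_self (abs_nonneg _) (by nlinarith)
  have h3 : |1 / (2 + y)| ≤ 1 := by
    rw [abs_of_nonneg (by positivity), div_le_one (by positivity)]; linarith
  have h4 : 1 / (2 + x) * ψ (1 / (1 + x)) - 1 / (2 + y) * ψ (1 / (1 + y)) =
      (1 / (2 + x) - 1 / (2 + y)) * ψ (1 / (1 + x)) +
        1 / (2 + y) * (ψ (1 / (1 + x)) - ψ (1 / (1 + y))) := by ring
  rw [h4, add_mul, one_mul]
  refine (abs_add_le _ _).trans (add_le_add ?_ ?_)
  · rw [abs_mul]
    exact (mul_le_of_le_one_right (abs_nonneg _) (hψb _)).trans h1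
  · rw [abs_mul]
    exact (mul_le_of_le_one_left (abs_nonneg _) h3).trans h2

theorem tendsto_gaussMeasure_gapOneSet_inter {k : ℕ} (hk : 1 ≤ k) :
    Tendsto (fun m => gaussMeasure.real (gapOneSet k ∩ gaussMap^[m] ⁻¹' gapOneSet k)) atTop
      (𝓝 (gaussMeasure.real (gapOneSet k) ^ 2)) := by
  obtain ⟨L, hL⟩ := exists_lipOnUnit_transferOp_gapOneSet hk
  have hm := measurableSet_gapOneSet k
  have h := tendsto_integral_mul_comp_iterate (measurable_one.indicator hm)
    (measurable_one.indicator hm) (abs_indicator_one_le _) (abs_indicator_one_le _) hL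
  rw [integral_indicator_one hm, ← sq] at h
  exact h.congr fun m => (measureReal_inter_preimage hm hm m).symm

/-! ### Cesàro means -/

/-- The sequence `u` has Cesàro mean `p`. -/
def HasMean (u : ℕ → ℝ) (p : ℝ) : Prop :=
  Tendsto (fun n : ℕ => (∑ i ∈ Finset.range n, u i) / n) atTop (𝓝 p)

theorem HasMean.add {u v : ℕ → ℝ} {p q : ℝ} (hu : HasMean u p) (hv : HasMean v q) :
    HasMean (fun i => u i + v i) (p + q) := by
  refine (Tendsto.add hu hv).congr fun n => ?_
  rw [Finset.sum_add_distrib, add_div]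

theorem HasMean.const_mul {u : ℕ → ℝ} {p : ℝ} (hu : HasMean u p) (c : ℝ) :
    HasMean (fun i => c * u i) (c * p) := by
  refine (Tendsto.const_mul c hu).congr fun n => ?_
  rw [← Finset.mul_sum, mul_div_assoc]

theorem hasMean_const (c : ℝ) : HasMean (fun _ => c) c := by
  refine tendsto_const_nhds.congr' ?_
  filter_upwards [eventually_gt_atTop 0] with n hn
  have : (n : ℝ) ≠ 0 := by positivity
  simp [mul_div_cancel_left₀ _ this]

theorem HasMean.sum {ι : Type*} {s : Finset ι} {u : ι → ℕ → ℝ} {p : ι → ℝ}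
    (h : ∀ j ∈ s, HasMean (u j) (p j)) : HasMean (fun i => ∑ j ∈ s, u j i) (∑ j ∈ s, p j) := by
  refine (tendsto_finsetSum s h).congr fun n => ?_
  rw [Finset.sum_comm, Finset.sum_div]

theorem tendsto_mean_shift_sub {u : ℕ → ℝ} {B : ℝ} (hB : ∀ i, |u i| ≤ B) (s : ℕ) :
    Tendsto (fun n : ℕ => (∑ i ∈ Finset.range n, u (i + s)) / n -
      (∑ i ∈ Finset.range n, u i) / n) atTop (𝓝 0) := by
  have h1 : Tendsto (fun n : ℕ => (2 * s * B) / (n : ℝ)) atTop (𝓝 0) :=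
    tendsto_const_div_atTop_nhds_zero_nat _
  refine squeeze_zero_norm (fun n => ?_) h1
  have h2 : ∑ i ∈ Finset.range n, u (i + s) - ∑ i ∈ Finset.range n, u i =
      ∑ i ∈ Finset.range s, u (n + i) - ∑ i ∈ Finset.range s, u i := by
    have e1 := Finset.sum_range_add u n s
    have e2 := Finset.sum_range_add u s n
    rw [add_comm s n, e1] at e2
    simp only [add_comm _ s]
    linarith
  have h3 : ∀ t : ℕ → ℕ, |∑ i ∈ Finset.range s, u (t i)| ≤ s * B := fun t => by
    refine (Finset.abs_sum_le_sum_abs _ _).trans ?_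
    simpa using Finset.sum_le_sum fun i (_ : i ∈ Finset.range s) => hB (t i)
  rw [← sub_div, h2, Real.norm_eq_abs, abs_div, Nat.abs_cast]
  refine div_le_div_of_nonneg_right ?_ (Nat.cast_nonneg n)
  refine (abs_sub _ _).trans ?_
  have := h3 fun i => n + i
  have := h3 id
  simp only [id] at this
  linarith

theorem HasMean.shift {u : ℕ → ℝ} {p B : ℝ} (hu : HasMean u p) (hB : ∀ i, |u i| ≤ B) (s : ℕ) :
    HasMean (fun i => u (i + s)) p := by
  have := (tendsto_mean_shift_sub hB s).add hu
  simpa [HasMean] using this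

/-- Reconciles `blockFreq`, which divides n+1 terms by n, with the usual mean. -/
theorem hasMean_iff_range_succ {u : ℕ → ℝ} {B : ℝ} (hB : ∀ i, |u i| ≤ B) (p : ℝ) :
    Tendsto (fun n : ℕ => (∑ i ∈ Finset.range (n + 1), u i) / n) atTop (𝓝 p) ↔ HasMean u p := by
  have h : Tendsto (fun n : ℕ => u n / n) atTop (𝓝 0) := by
    refine squeeze_zero_norm (fun n => ?_) (tendsto_const_div_atTop_nhds_zero_nat B)
    rw [Real.norm_eq_abs, abs_div, Nat.abs_cast]
    exact div_le_div_of_nonneg_right (hB n) (Nat.cast_nonneg n)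
  constructor
  · intro H
    have := H.sub h
    rw [sub_zero] at this
    refine this.congr fun n => ?_
    rw [Finset.sum_range_succ, add_div, add_sub_cancel_right]
  · intro H
    have := Tendsto.add H h
    rw [add_zero] at this
    refine this.congr fun n => ?_
    rw [Finset.sum_range_succ, add_div]

section Countable

variable {ι : Type*} [Countable ι] [MeasurableSpace ι] [MeasurableSingletonClass ι]

theorem exists_finset_lt_measureReal (ν : Measure ι) [IsFiniteMeasure ν] (S : Set ι) {ε : ℝ}
    (hε : 0 < ε) :
    ∃ F : Finset ι, (F : Set ι) ⊆ S ∧ ν.real S - ε < ∑ w ∈ F, ν.real {w} := by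
  classical
  have h1 := ν.tsum_indicator_apply_singleton S (Set.to_countable S).measurableSet
  have hne : ∀ w, S.indicator (fun w => ν {w}) w ≠ ⊤ := fun w => by
    by_cases hw : w ∈ S <;> simp [hw]
  have h2 := ENNReal.hasSum_toReal (f := S.indicator fun w => ν {w})
    (by rw [h1]; exact measure_ne_top _ _)
  rw [← ENNReal.tsum_toReal_eq hne, h1] at h2
  obtain ⟨F, hF⟩ := (h2.eventually (lt_mem_nhds (show ν.real S - ε < (ν S).toReal by
    rw [Measure.real]; linarith))).exists
  refine ⟨F.filter (· ∈ S), fun w hw => (Finset.mem_filter.1 hw).2, ?_⟩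
  rw [Finset.sum_filter]
  refine hF.trans_eq (Finset.sum_congr rfl fun w _ => ?_)
  by_cases hw : w ∈ S <;> simp [hw, Measure.real]

/-- If the frequency of every letter of a countable alphabet is its probability, then so is the
frequency of every set of letters. -/
theorem hasMean_of_hasMean_singleton (ν : Measure ι) [IsProbabilityMeasure ν] (f : ℕ → ι)
    (h : ∀ w, HasMean ((f ⁻¹' {w}).indicator 1) (ν.real {w})) (S : Set ι) :
    HasMean ((f ⁻¹' S).indicator 1) (ν.real S) := by
  classical
  -- Finitely many letters carry almost all the mass of S, which bounds the lower frequency; the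
  -- upper bound is the lower one for the complement, as the total mass is 1.
  have lower : ∀ (S : Set ι) (ε : ℝ), 0 < ε → ∀ᶠ n : ℕ in atTop,
      ν.real S - ε < (∑ i ∈ Finset.range n, (f ⁻¹' S).indicator (1 : ℕ → ℝ) i) / n := by
    intro S ε hε
    obtain ⟨F, hFS, hF⟩ := exists_finset_lt_measureReal ν S hε
    have hmean := HasMean.sum (s := F) fun w _ => h w
    filter_upwards [hmean.eventually (lt_mem_nhds hF)] with n hn
    refine hn.trans_le (div_le_div_of_nonneg_right ?_ (Nat.cast_nonneg n))
    refine Finset.sum_le_sum fun i _ => ?_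
    by_cases hi : f i ∈ S
    · have : (f ⁻¹' S).indicator (1 : ℕ → ℝ) i = 1 := by simp [hi]
      rw [this]
      have h2 : ∀ w, (f ⁻¹' {w}).indicator (1 : ℕ → ℝ) i = if f i = w then 1 else 0 := fun w => by
        simp [Set.indicator_apply]
      simp_rw [h2, Finset.sum_ite_eq]
      split_ifs <;> norm_num
    · rw [Finset.sum_eq_zero]
      · exact Set.indicator_nonneg (fun _ _ => zero_le_one) _
      · intro w hw
        refine Set.indicator_of_notMem (fun h' => hi ?_) _
        rw [Set.mem_preimage, Set.mem_singleton_iff] at h'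
        exact h' ▸ hFS hw
  refine tendsto_order.2 ⟨fun a ha => ?_, fun a ha => ?_⟩
  · filter_upwards [lower S (ν.real S - a) (by linarith)] with n hn
    linarith
  · filter_upwards [lower Sᶜ (a - ν.real S) (by linarith), eventually_gt_atTop 0] with n hn hn0
    have h1 : (n : ℝ) ≠ 0 := by positivity
    have h2 : (∑ i ∈ Finset.range n, (f ⁻¹' S).indicator (1 : ℕ → ℝ) i) / n +
        (∑ i ∈ Finset.range n, (f ⁻¹' Sᶜ).indicator (1 : ℕ → ℝ) i) / n = 1 := by
      rw [← add_div, ← Finset.sum_add_distrib]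
      simp [h1]
    rw [probReal_compl_eq_one_sub (Set.to_countable S).measurableSet] at hn
    linarith

end Countable

/-! ### Means along arithmetic progressions -/

theorem sum_sq_arithProg_le {w : ℕ → ℝ} {k : ℕ} (hk : 1 ≤ k) (r N : ℕ) :
    ∑ j ∈ Finset.range N, w (r + j * k) ^ 2 ≤ ∑ i ∈ Finset.range (r + N * k), w i ^ 2 := by
  have hinj : Function.Injective fun j => r + j * k := fun i j hij =>
    Nat.eq_of_mul_eq_mul_right hk (Nat.add_left_cancel hij)
  rw [← Finset.sum_image (f := fun i => w i ^ 2) hinj.injOn]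
  refine Finset.sum_le_sum_of_subset_of_nonneg (fun i hi => ?_) fun _ _ _ => sq_nonneg _
  obtain ⟨j, hj, rfl⟩ := Finset.mem_image.1 hi
  rw [Finset.mem_range] at hj ⊢
  have := Nat.mul_lt_mul_of_pos_right hj hk
  omega

theorem HasMean.tendsto_sum_arithProg_div {v : ℕ → ℝ} {p : ℝ} (h : HasMean v p) {k : ℕ}
    (hk : 1 ≤ k) (r : ℕ) :
    Tendsto (fun N : ℕ => (∑ i ∈ Finset.range (r + N * k), v i) / N) atTop (𝓝 (p * k)) := by
  have h1 : Tendsto (fun N : ℕ => r + N * k) atTop atTop :=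
    tendsto_atTop_mono (fun N => by simp only [id]; nlinarith [Nat.zero_le r]) tendsto_id
  have h2 : Tendsto (fun N : ℕ => (r : ℝ) / N + k) atTop (𝓝 (0 + k)) :=
    (tendsto_const_div_atTop_nhds_zero_nat _).add_const _
  rw [zero_add] at h2
  refine ((h.comp h1).mul h2).congr' ?_
  filter_upwards [eventually_gt_atTop 0] with N hN
  have hN' : (N : ℝ) ≠ 0 := by positivity
  have h3 : ((r + N * k : ℕ) : ℝ) ≠ 0 := by positivity
  simp only [Function.comp]
  have h4 : (r : ℝ) / N + k = ((r + N * k : ℕ) : ℝ) / N := by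
    push_cast; field_simp
  rw [h4, div_mul_div_cancel₀ h3]

theorem sum_sum_natDist_mul_le {c : ℕ → ℝ} {ε : ℝ} {M : ℕ} (L : ℕ) (hε : 0 ≤ ε) (h0 : c 0 ≤ 1)
    (hM : ∀ m, M ≤ m → c m ≤ ε) :
    ∑ l ∈ Finset.range L, ∑ l' ∈ Finset.range L, c (Nat.dist l l' * M) ≤ L + L ^ 2 * ε := by
  have h : ∀ l ∈ Finset.range L, ∀ l' ∈ Finset.range L,
      c (Nat.dist l l' * M) ≤ (if l = l' then 1 else 0) + ε := by
    intro l _ l' _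
    split_ifs with hl
    · subst hl
      rw [Nat.dist_self, zero_mul]
      linarith
    · rw [zero_add]
      refine hM _ (Nat.le_mul_of_pos_left _ ?_)
      exact Nat.pos_of_ne_zero fun h' => hl (Nat.eq_of_dist_eq_zero h')
  refine (Finset.sum_le_sum fun l hl => Finset.sum_le_sum (h l hl)).trans_eq ?_
  simp only [Finset.sum_add_distrib, Finset.sum_ite_eq, Finset.sum_const, Finset.card_range,
    nsmul_eq_mul]
  rw [Finset.sum_congr rfl fun l hl => if_pos hl]
  simp
  ring

/-- A van der Corput type lemma: if the autocorrelations of a bounded sequence along multiples of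
`k` exist and tend to zero, then its means along residue classes modulo `k` vanish. -/
theorem hasMean_arithProg_of_autocorrelation {u c : ℕ → ℝ} {k : ℕ} (hk : 1 ≤ k)
    (hu : ∀ i, |u i| ≤ 1) (hc : ∀ m, HasMean (fun i => u i * u (i + m * k)) (c m))
    (hc0 : Tendsto c atTop (𝓝 0)) (r : ℕ) : HasMean (fun j => u (r + j * k)) 0 := by
  have hk0 : (0 : ℝ) < k := by exact_mod_cast hk
  have hc1 : c 0 ≤ 1 := by
    refine le_of_tendsto_of_tendsto' (hc 0) (hasMean_const 1) fun n => ?_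
    refine div_le_div_of_nonneg_right (Finset.sum_le_sum fun i _ => ?_) (Nat.cast_nonneg n)
    refine (le_abs_self _).trans ?_
    rw [abs_mul]
    exact mul_le_one₀ (hu _) (abs_nonneg _) (hu _)
  refine Metric.tendsto_atTop'.2 fun η hη => ?_
  -- Chosen so that 2εk = η²/8 is below (η/2)²: restricting a sum of squares to one residue class
  -- costs a factor k.
  set ε := η ^ 2 / (16 * k) with hεdef
  have hε : 0 < ε := by positivity
  obtain ⟨M, hM⟩ := eventually_atTop.1 (hc0.eventually (ge_mem_nhds hε))
  obtain ⟨L', hL'⟩ := exists_nat_one_div_lt hε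
  set L := L' + 1
  have hL0 : (0 : ℝ) < L := by positivity
  have hLε : 1 / (L : ℝ) ≤ ε := by simpa [L] using hL'.le
  -- Summing L translates by multiples of Mk stays in the residue class, so there w has mean close
  -- to L times that of u. Over all i its mean square is C ≤ 2εL²: the L diagonal correlations are
  -- at most 1 each, the others at most ε.
  set w : ℕ → ℝ := fun i => ∑ l ∈ Finset.range L, u (i + l * M * k)
  set C := ∑ l ∈ Finset.range L, ∑ l' ∈ Finset.range L, c (Nat.dist l l' * M)
  have hC : C ≤ 2 * ε * L ^ 2 := by
    have h1 := sum_sum_natDist_mul_le L hε.le hc1 hM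
    have h2 : (L : ℝ) ≤ ε * L ^ 2 := by
      rw [div_le_iff₀ hL0] at hLε
      nlinarith
    linarith
  have hcorr : ∀ l l' : ℕ, HasMean (fun i => u (i + l * M * k) * u (i + l' * M * k))
      (c (Nat.dist l l' * M)) := by
    have key : ∀ l l' : ℕ, l ≤ l' →
        HasMean (fun i => u (i + l * M * k) * u (i + l' * M * k)) (c (Nat.dist l l' * M)) := by
      intro l l' hll
      obtain ⟨d, rfl⟩ := Nat.exists_eq_add_of_le hll
      have h1 := (hc (d * M)).shift (B := 1) (fun i => by
        rw [abs_mul]; exact mul_le_one₀ (hu _) (abs_nonneg _) (hu _)) (l * M * k)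
      rw [Nat.dist_eq_sub_of_le hll, Nat.add_sub_cancel_left]
      have h2 : ∀ i, i + l * M * k + d * M * k = i + (l + d) * M * k := fun i => by ring
      simpa only [h2] using h1
    intro l l'
    rcases le_total l l' with h | h
    · exact key l l' h
    · rw [Nat.dist_comm]
      simpa only [mul_comm] using key l' l h
  have hw : HasMean (fun i => w i ^ 2) C := by
    have h1 : (fun i => w i ^ 2) = fun i => ∑ l ∈ Finset.range L, ∑ l' ∈ Finset.range L,
        u (i + l * M * k) * u (i + l' * M * k) := by
      funext i
      simp only [w, sq, Finset.sum_mul_sum]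
    rw [h1]
    exact HasMean.sum fun l _ => HasMean.sum fun l' _ => hcorr l l'
  have hlim1 := hw.tendsto_sum_arithProg_div hk r
  have hlt : C * k < (η / 2) ^ 2 * L ^ 2 := by
    have h1 : C * k ≤ 2 * ε * L ^ 2 * k := mul_le_mul_of_nonneg_right hC hk0.le
    have h2 : 2 * ε * L ^ 2 * k = η ^ 2 / 8 * L ^ 2 := by
      rw [hεdef]; field_simp; ring
    have h3 : 0 < η ^ 2 * (L : ℝ) ^ 2 := by positivity
    nlinarith
  have hlim2 : Tendsto (fun N : ℕ => ∑ l ∈ Finset.range L,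
      ((∑ j ∈ Finset.range N, u (r + (j + l * M) * k)) / N -
        (∑ j ∈ Finset.range N, u (r + j * k)) / N)) atTop (𝓝 0) := by
    have := tendsto_finsetSum (Finset.range L) fun l _ =>
      tendsto_mean_shift_sub (u := fun j => u (r + j * k)) (fun i => hu _) (l * M)
    simpa using this
  have hev2 := (Metric.tendsto_atTop'.1 hlim2) (η / 2 * L) (by positivity)
  obtain ⟨N1, hN1⟩ := hev2
  obtain ⟨N2, hN2⟩ := eventually_atTop.1 (hlim1.eventually (gt_mem_nhds hlt))
  refine ⟨max N1 N2, fun N hN => ?_⟩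
  have hN1' := hN1 N (lt_of_le_of_lt (le_max_left _ _) hN)
  have hN2' := hN2 N (le_trans (le_max_right _ _) hN.le)
  have hN0 : (0 : ℝ) < N := by
    have : 0 < N := by omega
    exact_mod_cast this
  rw [Real.dist_eq, sub_zero] at hN1' ⊢
  set V := (∑ j ∈ Finset.range N, u (r + j * k)) / N
  set W := ∑ j ∈ Finset.range N, w (r + j * k)
  have hsum : ∑ l ∈ Finset.range L, ((∑ j ∈ Finset.range N, u (r + (j + l * M) * k)) / N - V) =
      W / N - L * V := by
    rw [Finset.sum_sub_distrib, ← Finset.sum_div, Finset.sum_comm]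
    simp only [Finset.sum_const, Finset.card_range, nsmul_eq_mul, W, w]
    congr 3
    funext j
    refine Finset.sum_congr rfl fun l _ => ?_
    congr 1
    ring
  rw [hsum] at hN1'
  -- Cauchy–Schwarz on the progression, then positivity of squares to pass to all indices.
  have hCS : (W / N) ^ 2 ≤ (∑ i ∈ Finset.range (r + N * k), w i ^ 2) / N := by
    have h1 := sq_sum_le_card_mul_sum_sq (s := Finset.range N) (f := fun j => w (r + j * k))
    rw [Finset.card_range] at h1
    have h2 := sum_sq_arithProg_le (w := w) hk r N
    rw [div_pow, div_le_div_iff₀ (by positivity) hN0]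
    have h3 := mul_le_mul_of_nonneg_left h2 hN0.le
    nlinarith
  have hW : |W / N| < η / 2 * L := by
    refine abs_lt_of_sq_lt_sq ?_ (by positivity)
    rw [mul_pow]
    exact lt_of_le_of_lt hCS hN2'
  have h4 : |L * V| < η * L := by
    have h5 := abs_sub_abs_le_abs_sub (L * V) (W / N)
    rw [abs_sub_comm] at h5
    linarith
  rw [abs_mul, abs_of_pos hL0, mul_comm] at h4
  exact lt_of_mul_lt_mul_right h4 hL0.le

/-! ### Existence and uniqueness of a number with given partial quotients -/

/-- The candidate orbits satisfying the first N relations form nested compact subsets of the cube.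
Each is nonempty, since a solution for the shifted digits extends by one term in front. -/
theorem exists_mem_unitInterval_recursion (d : ℕ → ℕ) (hd : ∀ n, 1 ≤ d n) :
    ∃ w : ℕ → ℝ, (∀ n, w n ∈ Set.Icc (0 : ℝ) 1) ∧ ∀ n, w n * (d n + w (n + 1)) = 1 := by
  set K : Set (ℕ → ℝ) := Set.univ.pi fun _ => Set.Icc (0 : ℝ) 1
  set F : ℕ → Set (ℕ → ℝ) := fun N => K ∩ {w | ∀ n < N, w n * (d n + w (n + 1)) = 1}
  have hK : IsCompact K := isCompact_univ_pi fun _ => isCompact_Icc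
  have hclosed : ∀ N, IsClosed {w : ℕ → ℝ | ∀ n < N, w n * (d n + w (n + 1)) = 1} := by
    intro N
    have : {w : ℕ → ℝ | ∀ n < N, w n * (d n + w (n + 1)) = 1} =
        ⋂ (n : ℕ) (_ : n < N), {w : ℕ → ℝ | w n * (d n + w (n + 1)) = 1} := by ext; simp
    rw [this]
    exact isClosed_biInter fun n _ => isClosed_eq (by fun_prop) continuous_const
  have hFK : ∀ N, IsCompact (F N) := fun N => hK.inter_right (hclosed N)
  have hanti : ∀ N, F (N + 1) ⊆ F N := fun N w hw =>
    ⟨hw.1, fun n hn => hw.2 n (by omega)⟩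
  have hne : ∀ N, (F N).Nonempty := by
    have key : ∀ (N : ℕ) (d : ℕ → ℕ), (∀ n, 1 ≤ d n) → ∃ w : ℕ → ℝ,
        (∀ n, w n ∈ Set.Icc (0 : ℝ) 1) ∧ ∀ n < N, w n * (d n + w (n + 1)) = 1 := by
      intro N
      induction N with
      | zero => exact fun d _ => ⟨0, fun n => by simp, fun n hn => by omega⟩
      | succ N ih =>
        intro d hd
        obtain ⟨w, hw1, hw2⟩ := ih (fun n => d (n + 1)) fun n => hd _
        have hd0 : (1 : ℝ) ≤ d 0 := by exact_mod_cast hd 0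
        have hpos : 0 < (d 0 : ℝ) + w 0 := by linarith [(hw1 0).1]
        refine ⟨fun n => Nat.casesOn n (1 / (d 0 + w 0)) w, fun n => ?_, fun n hn => ?_⟩
        · cases n with
          | zero =>
            refine ⟨one_div_nonneg.2 hpos.le, (div_le_one hpos).2 ?_⟩
            linarith [(hw1 0).1]
          | succ n => exact hw1 n
        · cases n with
          | zero => exact one_div_mul_cancel hpos.ne'
          | succ n => exact hw2 n (by omega)
    intro N
    obtain ⟨w, hw1, hw2⟩ := key N d hd
    exact ⟨w, fun n _ => hw1 n, hw2⟩
  obtain ⟨w, hw⟩ := IsCompact.nonempty_iInter_of_sequence_nonempty_isCompact_isClosed F hanti hne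
    (hFK 0) fun N => (hFK N).isClosed
  rw [Set.mem_iInter] at hw
  exact ⟨w, fun n => (hw 0).1 n trivial, fun n => (hw (n + 1)).2 n (by omega)⟩

theorem exists_hasCFExpansion (d : ℕ → ℕ) (hd : ∀ n, 1 ≤ n → 1 ≤ d n) :
    ∃ y, HasCFExpansion y d := by
  obtain ⟨w, hw1, hw2⟩ := exists_mem_unitInterval_recursion (fun n => d (n + 1))
    fun n => hd _ (by omega)
  have hd1 : ∀ n, (1 : ℝ) ≤ d (n + 1) := fun n => by exact_mod_cast hd (n + 1) (by omega)
  have hpos : ∀ n, 0 < w n := by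
    intro n
    refine lt_of_le_of_ne (hw1 n).1 fun h => ?_
    have := hw2 n
    rw [← h, zero_mul] at this
    exact zero_ne_one this
  have hlt : ∀ n, w n < 1 := by
    intro n
    have h1 := hw2 n
    have h2 := hpos (n + 1)
    have h3 := hd1 n
    have h4 := hpos n
    nlinarith
  have hmem : ∀ n, w n ∈ Set.Ico (0 : ℝ) 1 := fun n => ⟨(hw1 n).1, hlt n⟩
  have heq : ∀ n, w n = 1 / ((d (n + 1) : ℕ) + w (n + 1)) := by
    intro n
    have h3 := hd1 n
    have h2 := hpos (n + 1)
    exact eq_one_div_of_mul_eq_one_left (hw2 n)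
  have hiter : ∀ n, gaussMap^[n] (w 0) = w n := by
    intro n
    induction n with
    | zero => rfl
    | succ n ih =>
      rw [Function.iterate_succ_apply', ih, heq n, gaussMap_one_div_add (hmem _)]
  refine ⟨w 0, hasCFExpansion_iff.2 ⟨hmem 0, fun i => ?_⟩⟩
  refine ⟨by rw [hiter]; exact (hpos i).ne', ?_⟩
  have := cfDigit_iterate (w 0) i 0
  rw [add_zero] at this
  rw [← this, hiter, heq i, cfDigit_one_div_add (hmem _)]

theorem HasCFExpansion.gaussMap {x : ℝ} {a : ℕ → ℕ} (h : HasCFExpansion x a) :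
    HasCFExpansion (gaussMap x) fun n => a (n + 1) := by
  rw [hasCFExpansion_iff] at h ⊢
  refine ⟨gaussMap_mem_Ico x, fun i => ?_⟩
  have := h.2 (i + 1)
  rw [Function.iterate_succ_apply] at this
  refine ⟨this.1, ?_⟩
  rw [← this.2, cfDigit, cfDigit, Function.iterate_succ_apply]

theorem HasCFExpansion.pos {x : ℝ} {a : ℕ → ℕ} (h : HasCFExpansion x a) : 0 < x :=
  lt_of_le_of_ne h.1.1 ((hasCFExpansion_iff.1 h).2 0).1.symm

theorem HasCFExpansion.mul_add_gaussMap {x : ℝ} {a : ℕ → ℕ} (h : HasCFExpansion x a) :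
    x * (a 1 + CFNormality.gaussMap x) = 1 := by
  have h1 := one_div_eq_cfDigit_add h.pos.le
  rw [((hasCFExpansion_iff.1 h).2 0).2] at h1
  rw [← h1, mul_one_div_cancel h.pos.ne']

theorem HasCFExpansion.one_le {x : ℝ} {a : ℕ → ℕ} (h : HasCFExpansion x a) {n : ℕ} (hn : 1 ≤ n) :
    1 ≤ a n := by
  obtain ⟨m, rfl⟩ : ∃ m, n = m + 1 := ⟨n - 1, by omega⟩
  have := (hasCFExpansion_iff.1 h).2 m
  rw [← this.2]
  exact one_le_cfDigit h.mem_Ico this.1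

/-- One step multiplies distances by xy, which may be close to 1. Over two steps the factor is
(x·Tx)(y·Ty), and each product is at most 1/2 because x·a₁ + x·Tx = 1 with a₁ ≥ 1 > Tx. -/
theorem HasCFExpansion.abs_sub_le {x y : ℝ} {a : ℕ → ℕ} (hx : HasCFExpansion x a)
    (hy : HasCFExpansion y a) :
    |x - y| ≤ 1 / 4 * |CFNormality.gaussMap (CFNormality.gaussMap x) -
      CFNormality.gaussMap (CFNormality.gaussMap y)| := by
  have step : ∀ {x y : ℝ} {a : ℕ → ℕ}, HasCFExpansion x a → HasCFExpansion y a →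
      |x - y| = x * y * |CFNormality.gaussMap x - CFNormality.gaussMap y| := by
    intro x y a hx hy
    have h1 := hx.mul_add_gaussMap
    have h2 := hy.mul_add_gaussMap
    have h3 : x - y = x * y * (CFNormality.gaussMap y - CFNormality.gaussMap x) := by
      linear_combination y * h1 - x * h2
    have hx0 := hx.pos
    have hy0 := hy.pos
    rw [h3, abs_mul, abs_of_pos (by positivity), abs_sub_comm]
  have half : ∀ {x : ℝ}, HasCFExpansion x a → x * CFNormality.gaussMap x ≤ 1 / 2 := by
    intro x hx
    have h1 := hx.mul_add_gaussMap
    have h2 : (1 : ℝ) ≤ a 1 := by exact_mod_cast hx.one_le le_rfl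
    have h3 := hx.pos
    have h4 := gaussMap_mem_Ico x
    nlinarith [mul_le_mul_of_nonneg_left h2 h3.le, mul_le_mul_of_nonneg_left h4.2.le h3.le]
  rw [step hx hy, step hx.gaussMap hy.gaussMap, ← mul_assoc]
  refine mul_le_mul_of_nonneg_right ?_ (abs_nonneg _)
  have h1 := half hx
  have h2 := half hy
  have h3 : 0 ≤ y * CFNormality.gaussMap y := mul_nonneg hy.pos.le (gaussMap_mem_Ico y).1
  nlinarith

theorem HasCFExpansion.eq {x y : ℝ} {a : ℕ → ℕ} (hx : HasCFExpansion x a)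
    (hy : HasCFExpansion y a) : x = y := by
  have key : ∀ (n : ℕ) {x y : ℝ} {a : ℕ → ℕ}, HasCFExpansion x a → HasCFExpansion y a →
      |x - y| ≤ (1 / 4) ^ n := by
    intro n
    induction n with
    | zero =>
      intro x y a hx hy
      rw [pow_zero, abs_le]
      constructor <;> linarith [hx.1.1, hx.1.2, hy.1.1, hy.1.2]
    | succ n ih =>
      intro x y a hx hy
      refine (hx.abs_sub_le hy).trans ?_
      rw [pow_succ']
      exact mul_le_mul_of_nonneg_left (ih hx.gaussMap.gaussMap hy.gaussMap.gaussMap) (by norm_num)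
  have h1 : |x - y| ≤ 0 := ge_of_tendsto'
    (tendsto_pow_atTop_nhds_zero_of_lt_one (by norm_num) (by norm_num)) fun n => key n hx hy
  exact sub_eq_zero.1 (abs_eq_zero.1 (le_antisymm h1 (abs_nonneg _)))

/-! ### From normality to frequencies along progressions -/

/-- Points of `[0,1)` with an infinite continued fraction expansion. -/
def HasInfiniteExpansion (z : ℝ) : Prop :=
  z ∈ Set.Ico (0 : ℝ) 1 ∧ ∀ n, gaussMap^[n] z ≠ 0

theorem HasInfiniteExpansion.iterate {z : ℝ} (h : HasInfiniteExpansion z) (i : ℕ) :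
    HasInfiniteExpansion (gaussMap^[i] z) :=
  ⟨iterate_gaussMap_mem_Ico h.1 i, fun n => by
    rw [← Function.iterate_add_apply]; exact h.2 _⟩

theorem HasCFExpansion.hasInfiniteExpansion {x : ℝ} {a : ℕ → ℕ} (h : HasCFExpansion x a) :
    HasInfiniteExpansion x :=
  ⟨h.mem_Ico, fun n => ((hasCFExpansion_iff.1 h).2 n).1⟩

/-- The points whose orbit vanishes at time n are the preimage of a null set under a
measure-preserving map. -/
theorem ae_hasInfiniteExpansion : ∀ᵐ z ∂gaussMeasure, HasInfiniteExpansion z := by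
  have h1 : ∀ᵐ z ∂gaussMeasure, ∀ n, gaussMap^[n] z ≠ 0 := by
    refine ae_all_iff.2 fun n => ?_
    refine (measurePreserving_gaussMap.iterate n).quasiMeasurePreserving.ae
      (p := fun z => z ≠ 0) ?_
    filter_upwards [ae_gaussMeasure_mem_Ioo] with z hz using hz.1.ne'
  filter_upwards [ae_gaussMeasure_mem_Ioo, h1] with z hz hz1
  exact ⟨Set.Ioo_subset_Ico_self hz, hz1⟩

/-- The word of the first `ℓ` partial quotients. -/
noncomputable def cfWord (ℓ : ℕ) (z : ℝ) : Fin ℓ → ℕ := fun j => cfDigit z j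

theorem measurable_cfWord (ℓ : ℕ) : Measurable (cfWord ℓ) :=
  measurable_pi_lambda _ fun j => measurable_cfDigit j

theorem HasInfiniteExpansion.mem_cylinder_ofFn_iff {z : ℝ} (h : HasInfiniteExpansion z) {ℓ : ℕ}
    (w : Fin ℓ → ℕ) : z ∈ cylinder (List.ofFn w) ↔ cfWord ℓ z = w := by
  rw [mem_cylinder_iff h.1]
  constructor
  · intro H
    funext j
    have := (H j (by simp)).2
    simpa [cfWord] using this
  · rintro rfl i hi
    exact ⟨h.2 i, by simp [cfWord]⟩

theorem HasInfiniteExpansion.mem_cylinder_one_iff {z : ℝ} (h : HasInfiniteExpansion z) :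
    z ∈ cylinder [1] ↔ cfDigit z 0 = 1 := by
  rw [mem_cylinder_iff h.1]
  constructor
  · intro H
    simpa using (H 0 (by simp)).2
  · intro H i hi
    obtain rfl : i = 0 := by simpa using hi
    exact ⟨h.2 0, by simpa using H⟩

theorem HasInfiniteExpansion.mem_cylinder_one_one_iff {z : ℝ} (h : HasInfiniteExpansion z) :
    z ∈ cylinder [1, 1] ↔ cfDigit z 0 = 1 ∧ cfDigit z 1 = 1 := by
  rw [mem_cylinder_iff h.1]
  constructor
  · intro H
    exact ⟨by simpa using (H 0 (by simp)).2, by simpa using (H 1 (by simp)).2⟩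
  · rintro ⟨H0, H1⟩ i hi
    refine ⟨h.2 i, ?_⟩
    have hi' : i = 0 ∨ i = 1 := by simp at hi; omega
    rcases hi' with rfl | rfl
    · simpa using H0
    · simpa using H1

theorem HasInfiniteExpansion.mem_gapOneSet_iff {z : ℝ} (h : HasInfiniteExpansion z) (k : ℕ) :
    z ∈ gapOneSet k ↔ cfDigit z 0 = 1 ∧ cfDigit z k = 1 := by
  rw [gapOneSet, Set.mem_inter_iff, Set.mem_preimage, h.mem_cylinder_one_iff,
    (h.iterate k).mem_cylinder_one_iff, cfDigit_iterate, add_zero]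

theorem blockFreq_eq (w : List ℕ) (x : ℝ) (n : ℕ) :
    blockFreq w x n =
      (∑ i ∈ Finset.range (n + 1), ({i | gaussMap^[i] x ∈ cylinder w}.indicator 1 : ℕ → ℝ) i) /
        n := by
  classical
  unfold blockFreq
  congr 1
  rw [Finset.card_filter]
  push_cast
  refine Finset.sum_congr rfl fun i _ => ?_
  simp only [Set.indicator_apply, Set.mem_ofPred_eq, Pi.one_apply]

theorem abs_indicator_nat_le (s : Set ℕ) (i : ℕ) : |s.indicator (1 : ℕ → ℝ) i| ≤ 1 := by
  by_cases hx : i ∈ s <;> simp [hx]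

theorem tendsto_blockFreq_iff (w : List ℕ) (x p : ℝ) :
    Tendsto (blockFreq w x) atTop (𝓝 p) ↔
      HasMean ({i | gaussMap^[i] x ∈ cylinder w}.indicator 1) p := by
  rw [← hasMean_iff_range_succ (abs_indicator_nat_le _)]
  exact tendsto_congr fun n => blockFreq_eq w x n

/-- For a normal number, the orbit visits every set determined by finitely many partial quotients
with frequency equal to its Gauss measure. -/
theorem IsCFNormal.hasMean_of_determined {x : ℝ} (hx : IsCFNormal x) (hinf : HasInfiniteExpansion x)
    {ℓ : ℕ} {D : Set ℝ} (S : Set (Fin ℓ → ℕ))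
    (hD : ∀ z, HasInfiniteExpansion z → (z ∈ D ↔ cfWord ℓ z ∈ S)) :
    HasMean ({i | gaussMap^[i] x ∈ D}.indicator 1) (gaussMeasure.real D) := by
  have hprob : IsProbabilityMeasure (gaussMeasure.map (cfWord ℓ)) :=
    Measure.isProbabilityMeasure_map (measurable_cfWord ℓ).aemeasurable
  have hSm : ∀ S : Set (Fin ℓ → ℕ), MeasurableSet S := fun S => (Set.to_countable S).measurableSet
  have hae : ∀ {D : Set ℝ} {S : Set (Fin ℓ → ℕ)},
      (∀ z, HasInfiniteExpansion z → (z ∈ D ↔ cfWord ℓ z ∈ S)) →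
      (gaussMeasure.map (cfWord ℓ)).real S = gaussMeasure.real D := by
    intro D S hD
    rw [map_measureReal_apply (measurable_cfWord ℓ) (hSm S)]
    refine measureReal_congr ?_
    filter_upwards [ae_hasInfiniteExpansion] with z hz
    exact propext (hD z hz).symm
  -- The words of length ℓ are the letters of a countable alphabet; normality gives the frequency of
  -- each letter.
  have key := hasMean_of_hasMean_singleton (gaussMeasure.map (cfWord ℓ))
    (fun i => cfWord ℓ (gaussMap^[i] x)) (fun w => ?_) S
  · rw [hae hD] at key
    convert key using 2
    ext i
    exact hD _ (hinf.iterate i)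
  · have hw : ∀ z, HasInfiniteExpansion z →
        (z ∈ cylinder (List.ofFn w) ↔ cfWord ℓ z ∈ ({w} : Set (Fin ℓ → ℕ))) := fun z hz =>
      hz.mem_cylinder_ofFn_iff w
    have h1 := (tendsto_blockFreq_iff _ _ _).1 (hx.2 (List.ofFn w))
    rw [hae hw]
    convert h1 using 2
    · ext i
      exact (hw _ (hinf.iterate i)).symm
    · rfl

theorem IsCFNormal.hasMean_gapOneSet {x : ℝ} (hx : IsCFNormal x) (hinf : HasInfiniteExpansion x)
    (k : ℕ) :
    HasMean ({i | gaussMap^[i] x ∈ gapOneSet k}.indicator 1) (gaussMeasure.real (gapOneSet k)) := by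
  refine hx.hasMean_of_determined hinf (ℓ := k + 1)
    {w | w 0 = 1 ∧ w ⟨k, by omega⟩ = 1} fun z hz => ?_
  rw [hz.mem_gapOneSet_iff]
  rfl

theorem IsCFNormal.hasMean_gapOneSet_inter {x : ℝ} (hx : IsCFNormal x)
    (hinf : HasInfiniteExpansion x) (k m : ℕ) :
    HasMean ({i | gaussMap^[i] x ∈ gapOneSet k ∩ gaussMap^[m] ⁻¹' gapOneSet k}.indicator 1)
      (gaussMeasure.real (gapOneSet k ∩ gaussMap^[m] ⁻¹' gapOneSet k)) := by
  refine hx.hasMean_of_determined hinf (ℓ := m + k + 1)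
    {w | (w 0 = 1 ∧ w ⟨k, by omega⟩ = 1) ∧ (w ⟨m, by omega⟩ = 1 ∧ w ⟨m + k, by omega⟩ = 1)}
    fun z hz => ?_
  rw [Set.mem_inter_iff, Set.mem_preimage, hz.mem_gapOneSet_iff,
    (hz.iterate m).mem_gapOneSet_iff, cfDigit_iterate, cfDigit_iterate, add_zero]
  rfl

/-- The orbit of a normal number visits `gapOneSet k` with the right frequency along every
arithmetic progression of difference `k`. -/
theorem IsCFNormal.hasMean_gapOneSet_arithProg {x : ℝ} (hx : IsCFNormal x)
    (hinf : HasInfiniteExpansion x) {k : ℕ} (hk : 1 ≤ k) (r : ℕ) :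
    HasMean (fun j => ({i | gaussMap^[i] x ∈ gapOneSet k}.indicator 1 : ℕ → ℝ) (r + j * k))
      (gaussMeasure.real (gapOneSet k)) := by
  set e : ℕ → ℝ := {i | gaussMap^[i] x ∈ gapOneSet k}.indicator 1
  set α := gaussMeasure.real (gapOneSet k)
  have hα0 : 0 ≤ α := measureReal_nonneg
  have hα1 : α ≤ 1 := measureReal_le_one
  have he0 : ∀ i, 0 ≤ e i := fun i => Set.indicator_nonneg (fun _ _ => zero_le_one) _
  have he1 : ∀ i, e i ≤ 1 := fun i => (le_abs_self _).trans (abs_indicator_nat_le _ i)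
  have hmean : HasMean e α := hx.hasMean_gapOneSet hinf k
  have hu : ∀ i, |e i - α| ≤ 1 := fun i =>
    abs_le.2 ⟨by linarith [he0 i], by linarith [he1 i]⟩
  -- Expanding the product, the two cross terms contribute -α² each and the constant α².
  have hc : ∀ m, HasMean (fun i => (e i - α) * (e (i + m * k) - α))
      (gaussMeasure.real (gapOneSet k ∩ gaussMap^[m * k] ⁻¹' gapOneSet k) - α ^ 2) := by
    intro m
    have h1 := hx.hasMean_gapOneSet_inter hinf k (m * k)
    have h2 := hmean.shift (abs_indicator_nat_le _) (m * k)
    have h3 := ((h1.add (hmean.const_mul (-α))).add (h2.const_mul (-α))).add (hasMean_const (α ^ 2))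
    have h4 : ∀ i, (e i - α) * (e (i + m * k) - α) =
        ({i | gaussMap^[i] x ∈ gapOneSet k ∩ gaussMap^[m * k] ⁻¹' gapOneSet k}.indicator 1 :
          ℕ → ℝ) i + -α * e i + -α * e (i + m * k) + α ^ 2 := by
      intro i
      have h5 : ({i | gaussMap^[i] x ∈ gapOneSet k ∩ gaussMap^[m * k] ⁻¹' gapOneSet k}.indicator 1 :
          ℕ → ℝ) i = e i * e (i + m * k) := by
        classical
        simp only [e, Set.indicator_apply, Set.mem_ofPred_eq, Set.mem_inter_iff, Set.mem_preimage,
          Pi.one_apply, ← Function.iterate_add_apply, add_comm (m * k) i, ite_and]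
        split_ifs <;> simp
      rw [h5]; ring
    simp_rw [h4]
    convert h3 using 1
    ring
  have hc0 : Tendsto (fun m =>
      gaussMeasure.real (gapOneSet k ∩ gaussMap^[m * k] ⁻¹' gapOneSet k) - α ^ 2) atTop (𝓝 0) := by
    have h1 : Tendsto (fun m : ℕ => m * k) atTop atTop :=
      tendsto_atTop_mono (fun m => Nat.le_mul_of_pos_right m hk) tendsto_id
    have := ((tendsto_gaussMeasure_gapOneSet_inter hk).comp h1).sub_const (α ^ 2)
    rwa [sub_self] at this
  have := (hasMean_arithProg_of_autocorrelation hk hu hc hc0 r).add (hasMean_const α)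
  simpa using this

theorem tendsto_blockFreq_arithProg {x y : ℝ} {a : ℕ → ℕ} (hxa : HasCFExpansion x a)
    (hx : IsCFNormal x) {k b : ℕ} (hk : 1 ≤ k) (hb : 1 ≤ b)
    (hy : HasCFExpansion y fun n => a (b + (n - 1) * k)) :
    Tendsto (blockFreq [1, 1] y) atTop (𝓝 (gaussMeasure.real (gapOneSet k))) := by
  rw [tendsto_blockFreq_iff]
  have hxi := hxa.hasInfiniteExpansion
  have hyi := hy.hasInfiniteExpansion
  -- The residue is b-1 because orbit times start at 0 while the digits of x are numbered from 1.
  convert hx.hasMean_gapOneSet_arithProg hxi hk (b - 1) using 2 with j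
  have hxd := fun i => ((hasCFExpansion_iff.1 hxa).2 i).2
  have hyd := fun i => ((hasCFExpansion_iff.1 hy).2 i).2
  have h1 : gaussMap^[j] y ∈ cylinder [1, 1] ↔ gaussMap^[b - 1 + j * k] x ∈ gapOneSet k := by
    rw [(hyi.iterate j).mem_cylinder_one_one_iff, (hxi.iterate _).mem_gapOneSet_iff]
    simp only [cfDigit_iterate, hxd, hyd, add_zero, Nat.add_sub_cancel]
    rw [show b - 1 + j * k + 1 = b + j * k by omega,
      show b - 1 + j * k + k + 1 = b + (j + 1) * k by rw [add_mul]; omega]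
  classical
  simp only [Set.indicator_apply, Set.mem_ofPred_eq, h1, Pi.one_apply]

end CFNormality

theorem mainTheorem3 (x : ℝ) (a : ℕ → ℕ) (hxa : CFNormality.HasCFExpansion x a)
    (hx : CFNormality.IsCFNormal x) (k b : ℕ) (hk : 2 ≤ k) (hb : 1 ≤ b) :
    (∃! y : ℝ, CFNormality.HasCFExpansion y (fun n => a (b + (n - 1) * k))) ∧
    ∀ y : ℝ, CFNormality.HasCFExpansion y (fun n => a (b + (n - 1) * k)) →
      ¬ CFNormality.IsCFNormal y ∧
      Tendsto (CFNormality.blockFreq [1, 1] y) atTop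
        (𝓝 (CFNormality.gaussMeasure (CFNormality.cylinder [1] ∩
          CFNormality.gaussMap^[k] ⁻¹' CFNormality.cylinder [1])).toReal) ∧
      (CFNormality.gaussMeasure (CFNormality.cylinder [1] ∩
          CFNormality.gaussMap^[k] ⁻¹' CFNormality.cylinder [1])).toReal ≠
        (CFNormality.gaussMeasure (CFNormality.cylinder [1, 1])).toReal := by
  have hne := (CFNormality.gaussMeasure_cylinder_one_one_lt hk).ne'
  refine ⟨?_, fun y hy => ?_⟩
  · obtain ⟨y, hy⟩ := CFNormality.exists_hasCFExpansion (fun n => a (b + (n - 1) * k))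
      fun n _ => hxa.one_le (by omega)
    exact ⟨y, hy, fun z hz => hz.eq hy⟩
  · have hlim := CFNormality.tendsto_blockFreq_arithProg hxa hx (by omega) hb hy
    exact ⟨fun hn => hne (tendsto_nhds_unique hlim (hn.2 [1, 1])), hlim, hne⟩
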